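/- Let $\Gamma$ be a finitely generated group with unit $e$, let $|g|$ be the word length of $g\in\Gamma$ for a fixed finite generating set, and let $\lambda$ be the left regular representation of $\Gamma$ on $\ell^2(\Gamma)$, $\lambda(g)\delta_v=\delta_{gv}$. For $p=\sum_g p_g g\in\mathbb C[\Gamma]$ and a representation $\rho$ write $\rho(p)=\sum_g p_g\rho(g)$; for an operator $Q$ on $\ell^2(\Gamma)$ write $Q(x,y)=\langle\delta_x,Q\delta_y\rangle$ and $\Im Q=(Q-Q^*)/(2i)$. Along a sequence of integers $N\to\infty$, let $\rho_N:\Gamma\to S_N$ be homomorphisms to the symmetric groups, write $g.x=\rho_N(g)(x)$ for $x\in[N]=\{1,\dots,N\}$, and identify $\rho_N(g)$ with its permutation matrix, $\rho_N(g)(x,y)=\mathbf 1(x=g.y)$. Assume that $\rho_N$ converges strongly in distribution to $\lambda$, that is, $\frac1N\operatorname{Tr}\rho_N(g)\to0$ for every $g\ne e$, and $\|\rho_N(q)_{|1^\perp}\|_{\rm op}\to\|\lambda(q)\|_{\rm op}$ for every $q\in\mathbb C[\Gamma]$, where $1^\perp\subset\mathbb C^N$ is the orthogonal complement of the constant vector.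 Assume that $\Gamma$ has the rapid decay property with exponent $C_1>0$: for some finite generating set $S$ and some $C>0$, for every $q\in\mathbb C[\Gamma]$, $$\|\lambda(q)\|_{\rm op}\le C\,(\mathrm{diam}_S(q))^{C_1}\Big(\sum_g|q_g|^2\Big)^{1/2},$$ where $\mathrm{diam}_S(q)$ is the maximum of $1$ and the diameter of the support of $q$ in the left Cayley graph of $\Gamma$ with respect to $S$ (edges between $g$ and $sg$, $s\in S$). Let $p\in\mathbb C[\Gamma]$ with $p=p^*$, that is, $p_{g^{-1}}=\overline{p_g}$ for all $g$, let $R^z=(\lambda(p)-z\,\mathrm{Id})^{-1}$, and let $I_0\subset\mathbb R$ be a compact interval such that (i) for some $C_0\ge1$, $\;C_0^{-1}\le\Im R^{E+i\eta}(e,e)\le C_0\;$ for all $E\in I_0$ and $0<\eta\le1$; (ii) for some $C_1'>2C_1+1$, $$\lim_{\eta\to0^+}\ \sup_{E\in I_0}\ \sum_{g\in\Gamma}\eta^2\,|(\Im R^{E+i\eta})(e,g)|^4\,|g|^{C_1'}=0.$$ Let $I=[a,b]$, $a<b$, be a closed interval contained in the interior of $I_0$. For each $N$ let $(\varphi_\alpha)_{\alpha\in[N]}$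 be any orthonormal basis of $\mathbb C^N$ of eigenvectors of $P_N=\rho_N(p)$, with eigenvalues $(\lambda_\alpha)$, and let $\Lambda_J=\{\alpha:\lambda_\alpha\in J\}$ for $J\subset\mathbb R$. Let $T\subset\Gamma$ be finite and let $K_N\in M_N(\mathbb C)$ be any sequence of $T$-local matrices (that is, $K_N(x,y)=0$ unless $x=g.y$ for some $g\in T$) such that $|K_N(x,y)|\le1$ for all $x,y$. Put $$\langle K_N\rangle=\sum_{g\in T}\Big(\frac1N\sum_{x=1}^NK_N(g.x,x)\Big)\rho_N(g).$$ Then quantum ergodicity holds in $I$: $$\lim_{N\to\infty}\frac1{|\Lambda_I|}\sum_{\alpha\in\Lambda_I}\big|\langle\varphi_\alpha,K_N\varphi_\alpha\rangle-\langle\varphi_\alpha,\langle K_N\rangle\varphi_\alpha\rangle\big|^2=0,$$ and small-scale quantum mixing holds in $I$: for all $E_1,E_2$ in the interior of $I$, with $J_E^\eta=[E-\eta,E+\eta]$, $$\lim_{\eta\to0^+}\limsup_{N\to\infty}\frac1{|\Lambda_{J_{E_1}^\eta}|}\sum_{\alpha\in\Lambda_{J_{E_1}^\eta}}\ \sum_{\beta\in\Lambda_{J_{E_2}^\eta}}\big|\langle\varphi_\beta,K_N\varphi_\alpha\rangle-\langle\varphi_\beta,\langle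 K_N\rangle\varphi_\alpha\rangle\big|^2=0.$$ (An average over an empty set $\Lambda$ is read as $0$.) -/

import Mathlib

open Filter Topology

namespace QuantumMixing

noncomputable section

/-! Word metric on a group -/

/-- The word length of `g` with respect to `S`: the least length of a word in the elements of `S`
and their inverses whose product is `g`. -/
def wordLength {Γ : Type*} [Group Γ] (S : Finset Γ) (g : Γ) : ℕ :=
  sInf {n : ℕ | ∃ l : List Γ, (∀ s ∈ l, s ∈ S ∨ s⁻¹ ∈ S) ∧ l.prod = g ∧ l.length = n}

/-- `S` is a (finite) generating set of the group. -/
def Generates {Γ : Type*} [Group Γ] (S : Finset Γ) : Prop :=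
  Subgroup.closure (S : Set Γ) = ⊤

/-- The maximum of `1` and the diameter of the support of `p` in the left Cayley graph, whose edges
connect `g` to `s * g`; the distance between `g` and `h` is the word length of `h * g⁻¹`. -/
def supportDiam {Γ : Type*} [Group Γ] (S : Finset Γ) (p : MonoidAlgebra ℂ Γ) : ℕ :=
  max 1 (p.coeff.support.sup fun g => p.coeff.support.sup fun h => wordLength S (h * g⁻¹))

/-! The left regular representation -/

/-- The Hilbert space `ℓ²(Γ)`. -/
abbrev EllTwo (Γ : Type*) : Type _ := lp (fun _ : Γ => ℂ) 2

theorem memlp_translate {Γ : Type*} [Group Γ] (g : Γ) (f : EllTwo Γ) :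
    Memℓp (fun v : Γ => f (g⁻¹ * v)) 2 := by
  have h := (lp.memℓp f)
  rw [memℓp_gen_iff (by norm_num)] at h ⊢
  exact (Equiv.mulLeft g⁻¹).summable_iff.mpr h

theorem norm_translate {Γ : Type*} [Group Γ] (g : Γ) (f : EllTwo Γ) :
    ‖(⟨fun v : Γ => f (g⁻¹ * v), memlp_translate g f⟩ : EllTwo Γ)‖ = ‖f‖ := by
  rw [lp.norm_eq_tsum_rpow (by norm_num), lp.norm_eq_tsum_rpow (by norm_num)]
  congr 1
  exact (Equiv.mulLeft g⁻¹).tsum_eq (fun v => ‖f v‖ ^ (2 : ENNReal).toReal)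

/-- The operator `λ(g)` on `ℓ²(Γ)`: `(λ(g) f)(v) = f(g⁻¹ v)`, that is `λ(g) δ_v = δ_{g v}`. -/
def leftRegular {Γ : Type*} [Group Γ] (g : Γ) : EllTwo Γ →L[ℂ] EllTwo Γ :=
  LinearIsometry.toContinuousLinearMap
    { toFun := fun f => ⟨fun v : Γ => f (g⁻¹ * v), memlp_translate g f⟩
      map_add' := fun _ _ => rfl
      map_smul' := fun _ _ => rfl
      norm_map' := norm_translate g }

/-- `λ(p) = ∑_g p_g λ(g)` for `p` in the group algebra. -/
def regularOp {Γ : Type*} [Group Γ] (p : MonoidAlgebra ℂ Γ) : EllTwo Γ →L[ℂ] EllTwo Γ :=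
  p.coeff.sum fun g c => c • leftRegular g

open Classical in
/-- The basis vector `δ_v` of `ℓ²(Γ)`. -/
def delta {Γ : Type*} (v : Γ) : EllTwo Γ := lp.single 2 v (1 : ℂ)

/-- The matrix entry `Q(x, y) = ⟨δ_x, Q δ_y⟩` of an operator `Q` on `ℓ²(Γ)`. -/
def entry {Γ : Type*} (Q : EllTwo Γ →L[ℂ] EllTwo Γ) (x y : Γ) : ℂ :=
  inner ℂ (delta x) (Q (delta y))

/-- The resolvent `R^z = (P - z Id)⁻¹`. -/
def resolventOp {Γ : Type*} (P : EllTwo Γ →L[ℂ] EllTwo Γ) (z : ℂ) : EllTwo Γ →L[ℂ] EllTwo Γ :=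
  Ring.inverse (P - z • ContinuousLinearMap.id ℂ (EllTwo Γ))

/-- The imaginary part `(R - R*) / (2i)` of an operator. -/
def imOp {Γ : Type*} (R : EllTwo Γ →L[ℂ] EllTwo Γ) : EllTwo Γ →L[ℂ] EllTwo Γ :=
  (2 * Complex.I)⁻¹ • (R - ContinuousLinearMap.adjoint R)

/-- The entry `(Im R^z)(x, y)` of the imaginary part of the resolvent of `λ(p)`. -/
def imResolvent {Γ : Type*} [Group Γ] (p : MonoidAlgebra ℂ Γ) (z : ℂ) (x y : Γ) : ℂ :=
  entry (imOp (resolventOp (regularOp p) z)) x y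

/-! Assumptions on the group and on the symbol -/

/-- `p = p*`, that is, `p_{g⁻¹}` is the complex conjugate of `p_g` for all `g`. -/
def IsSymmetric {Γ : Type*} [Group Γ] (p : MonoidAlgebra ℂ Γ) : Prop :=
  ∀ g : Γ, p.coeff g⁻¹ = (starRingEnd ℂ) (p.coeff g)

/-- The rapid decay property of `Γ` with exponent `C₁`. -/
def RapidDecay (Γ : Type*) [Group Γ] (C₁ : ℝ) : Prop :=
  0 < C₁ ∧ ∃ S : Finset Γ, Generates S ∧ ∃ C : ℝ, 0 < C ∧ ∀ p : MonoidAlgebra ℂ Γ,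
    ‖regularOp p‖ ≤
      C * (supportDiam S p : ℝ) ^ C₁ * Real.sqrt (∑ g ∈ p.coeff.support, ‖p.coeff g‖ ^ 2)

/-- Two-sided resolvent bound on the set `I₀`: the diagonal entry of the imaginary part of the
resolvent of `λ(p)` is bounded above and below by positive constants as `z` approaches `I₀` from
the upper half-plane. (A lower bound uniform over all `Im z > 0` is impossible, as this entry is
at most `1 / Im z`.) -/
def TwoSidedResolventBound {Γ : Type*} [Group Γ] (p : MonoidAlgebra ℂ Γ) (I₀ : Set ℝ) : Prop :=
  ∃ C₀ : ℝ, 1 ≤ C₀ ∧ ∀ E ∈ I₀, ∀ η : ℝ, 0 < η → η ≤ 1 →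
    C₀⁻¹ ≤ (imResolvent p (E + η * Complex.I) 1 1).re ∧
      (imResolvent p (E + η * Complex.I) 1 1).re ≤ C₀

/-- Weighted fourth-moment decay of the imaginary part of the resolvent on `I₀`, where the weight
is the power `C₁'` of the word length with respect to `S`. -/
def ResolventFourthMomentDecay {Γ : Type*} [Group Γ] (S : Finset Γ) (p : MonoidAlgebra ℂ Γ)
    (I₀ : Set ℝ) (C₁' : ℝ) : Prop :=
  Tendsto (fun η : ℝ => ⨆ E ∈ I₀, ∑' g : Γ, ENNReal.ofReal
      (η ^ 2 * ‖imResolvent p (E + η * Complex.I) 1 g‖ ^ 4 * (wordLength S g : ℝ) ^ C₁'))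
    (𝓝[>] 0) (𝓝 0)

/-! Permutation representations -/

/-- The permutation matrix of `σ`: the entry at `(x, y)` is `1` if `x = σ y` and `0` otherwise. -/
def permMat {n : ℕ} (σ : Equiv.Perm (Fin n)) : Matrix (Fin n) (Fin n) ℂ :=
  Matrix.of fun x y => if x = σ y then 1 else 0

/-- `ρ(p) = ∑_g p_g ρ(g)` for a permutation representation `ρ`. -/
def permOp {Γ : Type*} [Group Γ] {n : ℕ} (ρ : Γ →* Equiv.Perm (Fin n))
    (p : MonoidAlgebra ℂ Γ) : Matrix (Fin n) (Fin n) ℂ :=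
  p.coeff.sum fun g c => c • permMat (ρ g)

/-- The vector with all coordinates equal to `1`. -/
def onesVec (n : ℕ) : EuclideanSpace ℂ (Fin n) := WithLp.toLp 2 fun _ => 1

/-- The operator norm of the restriction of a matrix to the orthogonal complement of the constant
vectors. -/
def normOnOnesPerp {n : ℕ} (A : Matrix (Fin n) (Fin n) ℂ) : ℝ :=
  ‖(Matrix.toEuclideanCLM (𝕜 := ℂ) A).comp (Submodule.span ℂ {onesVec n})ᗮ.subtypeL‖

/-- Convergence in distribution to the regular representation. -/
def ConvergesInDistribution {Γ : Type*} [Group Γ] (n : ℕ → ℕ)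
    (ρ : ∀ k, Γ →* Equiv.Perm (Fin (n k))) : Prop :=
  ∀ g : Γ, g ≠ 1 →
    Tendsto (fun k => (permMat (ρ k g)).trace / (n k : ℂ)) atTop (𝓝 0)

/-- Strong convergence in distribution to the regular representation. -/
def ConvergesStrongly {Γ : Type*} [Group Γ] (n : ℕ → ℕ)
    (ρ : ∀ k, Γ →* Equiv.Perm (Fin (n k))) : Prop :=
  ConvergesInDistribution n ρ ∧ ∀ p : MonoidAlgebra ℂ Γ,
    Tendsto (fun k => normOnOnesPerp (permOp (ρ k) p)) atTop (𝓝 ‖regularOp p‖)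

/-! Observables -/

/-- `K` is `T`-local: `K(x, y) = 0` unless `x = g.y` for some `g ∈ T`. -/
def IsLocal {Γ : Type*} [Group Γ] {n : ℕ} (ρ : Γ →* Equiv.Perm (Fin n)) (T : Finset Γ)
    (K : Matrix (Fin n) (Fin n) ℂ) : Prop :=
  ∀ x y, (¬ ∃ g ∈ T, x = ρ g y) → K x y = 0

/-- The average `⟨K⟩ = ρ(k)` of a `T`-local observable, where `k = ∑_{g ∈ T} k_g g` and
`k_g = (1/n) ∑_x K(g.x, x)`. -/
def average {Γ : Type*} [Group Γ] {n : ℕ} (ρ : Γ →* Equiv.Perm (Fin n)) (T : Finset Γ)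
    (K : Matrix (Fin n) (Fin n) ℂ) : Matrix (Fin n) (Fin n) ℂ :=
  permOp ρ (∑ g ∈ T, MonoidAlgebra.single g ((1 / (n : ℂ)) * ∑ x, K (ρ g x) x))

/-- The matrix coefficient `⟨φ, A ψ⟩`, conjugate-linear in `φ`. -/
def matrixCoeff {n : ℕ} (A : Matrix (Fin n) (Fin n) ℂ) (φ ψ : EuclideanSpace ℂ (Fin n)) : ℂ :=
  inner ℂ φ (Matrix.toEuclideanCLM (𝕜 := ℂ) A ψ)

/-- `φ` is a basis of eigenvectors of `A`, with eigenvalues `ev`. -/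
def IsEigenbasis {n : ℕ} (A : Matrix (Fin n) (Fin n) ℂ)
    (φ : OrthonormalBasis (Fin n) ℂ (EuclideanSpace ℂ (Fin n))) (ev : Fin n → ℝ) : Prop :=
  ∀ α, Matrix.toEuclideanCLM (𝕜 := ℂ) A (φ α) = (ev α : ℂ) • φ α

open Classical in
/-- The set `Λ_J` of indices whose eigenvalue lies in `J`. -/
def spectralIndices {n : ℕ} (ev : Fin n → ℝ) (J : Set ℝ) : Finset (Fin n) :=
  Finset.univ.filter fun α => ev α ∈ J

/-- `(1/|Λ_I|) ∑_{α ∈ Λ_I} |⟨φ_α, K φ_α⟩ - ⟨φ_α, A φ_α⟩|²`, where `A` is the centering. -/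
def ergodicVariance {n : ℕ} (φ : OrthonormalBasis (Fin n) ℂ (EuclideanSpace ℂ (Fin n)))
    (ev : Fin n → ℝ) (K A : Matrix (Fin n) (Fin n) ℂ) (I : Set ℝ) : ℝ :=
  (1 / ((spectralIndices ev I).card : ℝ)) *
    ∑ α ∈ spectralIndices ev I, ‖matrixCoeff K (φ α) (φ α) - matrixCoeff A (φ α) (φ α)‖ ^ 2

/-- `(1/|Λ_J|) ∑_{α ∈ Λ_J} ∑_{β ∈ Λ_J'} |⟨φ_β, K φ_α⟩ - ⟨φ_β, A φ_α⟩|²`, where `A` is the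
centering. -/
def mixingVariance {n : ℕ} (φ : OrthonormalBasis (Fin n) ℂ (EuclideanSpace ℂ (Fin n)))
    (ev : Fin n → ℝ) (K A : Matrix (Fin n) (Fin n) ℂ) (J J' : Set ℝ) : ℝ :=
  (1 / ((spectralIndices ev J).card : ℝ)) *
    ∑ α ∈ spectralIndices ev J, ∑ β ∈ spectralIndices ev J',
      ‖matrixCoeff K (φ β) (φ α) - matrixCoeff A (φ β) (φ α)‖ ^ 2

/-- Quantum ergodicity in `I`. -/
def QuantumErgodicity {Γ : Type*} [Group Γ] (n : ℕ → ℕ)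
    (ρ : ∀ k, Γ →* Equiv.Perm (Fin (n k)))
    (φ : ∀ k, OrthonormalBasis (Fin (n k)) ℂ (EuclideanSpace ℂ (Fin (n k))))
    (ev : ∀ k, Fin (n k) → ℝ) (T : Finset Γ)
    (K : ∀ k, Matrix (Fin (n k)) (Fin (n k)) ℂ) (I : Set ℝ) : Prop :=
  Tendsto (fun k => ergodicVariance (φ k) (ev k) (K k) (average (ρ k) T (K k)) I) atTop (𝓝 0)

/-- Small-scale quantum (weak) mixing in `I`. The upper limit is taken in `[0, ∞]`. -/
def SmallScaleQuantumMixing {Γ : Type*} [Group Γ] (n : ℕ → ℕ)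
    (ρ : ∀ k, Γ →* Equiv.Perm (Fin (n k)))
    (φ : ∀ k, OrthonormalBasis (Fin (n k)) ℂ (EuclideanSpace ℂ (Fin (n k))))
    (ev : ∀ k, Fin (n k) → ℝ) (T : Finset Γ)
    (K : ∀ k, Matrix (Fin (n k)) (Fin (n k)) ℂ) (I : Set ℝ) : Prop :=
  ∀ E₁ ∈ interior I, ∀ E₂ ∈ interior I,
    Tendsto (fun η : ℝ => limsup (fun k => ENNReal.ofReal
        (mixingVariance (φ k) (ev k) (K k) (average (ρ k) T (K k))
          (Set.Icc (E₁ - η) (E₁ + η)) (Set.Icc (E₂ - η) (E₂ + η)))) atTop)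
      (𝓝[>] 0) (𝓝 0)

end

end QuantumMixing

/-! Both conclusions follow from one estimate (`eventually_sum_sq_le`): for small η, and then for N
large, the sum of |⟨φ_β, (K − ⟨K⟩) φ_α⟩|² over α, β with eigenvalues in two windows of half-width η
centred in I₀ is at most εηN. Since such a window contains at least cηN eigenvalues
(`exists_card_spectralIndices_ge`), mixing is immediate. For ergodicity, I is covered by O(1/η)
windows, and the diagonal terms of each are bounded by its double sum.

For the estimate, K − ⟨K⟩ is written as a sum over g ∈ T of X = D_a ρ(g), with D_a the
multiplication by a bounded function a of mean zero, plus a collision part whose Hilbert–Schmidt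
norm squared is o(N) because few points are fixed by a given nontrivial element. The indicators of
the windows are dominated by 4η times polynomials q₁, q₂ that are nonnegative on the spectrum and
approximate Poisson kernels of width η. The double sum is then at most 16η² Tr(X* f₂ X f₁), where
f_i = q_i(p) is represented by ρ.

Expanding this trace over the group (`norm_trace_twisted_sub_le`), pairs u, v with vu = e give ⟨a,
ρ(h) a⟩ with h(u) = f₂(u) f₁(g⁻¹u⁻¹g), and all other pairs contribute o(N). As a is orthogonal to
the constants, strong convergence bounds the quadratic form by about 4N‖λ(h)‖. Rapid decay, summed
over spheres (`exists_norm_regularOp_le`), bounds ‖λ(h)‖ by a weighted ℓ² norm of h, hence by the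
square roots of the weighted fourth moments of f₁ and f₂. These coefficients approximate those of Im
R^{E+iη}, so the fourth-moment hypothesis makes ‖λ(h)‖ = o(1/η), and 16η² · N · o(1/η) = o(ηN).

The polynomials come from a truncated Neumann series for the Poisson kernel
(`exists_poisson_approx`): its degree grows linearly while its error is geometric, so polynomial
weights do no harm. -/

namespace QuantumMixing

noncomputable section

/-! ### Word length and supports in balls -/

section WordLength
variable {Γ : Type*} [Group Γ] {S : Finset Γ}

theorem wordLength_le (l : List Γ) (hl : ∀ s ∈ l, s ∈ S ∨ s⁻¹ ∈ S) :
    wordLength S l.prod ≤ l.length :=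
  Nat.sInf_le ⟨l, hl, rfl, rfl⟩

theorem exists_word (hS : Generates S) (g : Γ) :
    ∃ l : List Γ, (∀ s ∈ l, s ∈ S ∨ s⁻¹ ∈ S) ∧ l.prod = g ∧ l.length = wordLength S g := by
  have h : g ∈ Subgroup.closure (S : Set Γ) := by
    rw [show Subgroup.closure (S : Set Γ) = ⊤ from hS]; trivial
  rw [← Subgroup.mem_toSubmonoid, Subgroup.closure_toSubmonoid] at h
  obtain ⟨l, hl', hg⟩ := Submonoid.exists_list_of_mem_closure h
  have hl : ∀ s ∈ l, s ∈ S ∨ s⁻¹ ∈ S := fun s hs => by simpa using hl' s hs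
  exact Nat.sInf_mem (s := {n : ℕ | ∃ l : List Γ, (∀ s ∈ l, s ∈ S ∨ s⁻¹ ∈ S) ∧ l.prod = g ∧
    l.length = n}) ⟨l.length, l, hl, hg, rfl⟩

theorem wordLength_one : wordLength S (1 : Γ) = 0 := by
  simpa using wordLength_le (S := S) [] (by simp)

theorem eq_one_of_wordLength_eq_zero (hS : Generates S) {g : Γ} (h : wordLength S g = 0) :
    g = 1 := by
  obtain ⟨l, -, hg, hl⟩ := exists_word hS g
  rw [h, List.length_eq_zero_iff] at hl
  simpa [hl] using hg.symm

theorem wordLength_mul_le (hS : Generates S) (g h : Γ) :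
    wordLength S (g * h) ≤ wordLength S g + wordLength S h := by
  obtain ⟨l, hl, hg, hl'⟩ := exists_word hS g
  obtain ⟨m, hm, hh, hm'⟩ := exists_word hS h
  have := wordLength_le (S := S) (l ++ m) (by
    intro s hs
    rcases List.mem_append.1 hs with hs | hs
    exacts [hl s hs, hm s hs])
  rwa [List.prod_append, hg, hh, List.length_append, hl', hm'] at this

theorem wordLength_inv_le (hS : Generates S) (g : Γ) : wordLength S g⁻¹ ≤ wordLength S g := by
  obtain ⟨l, hl, hg, hl'⟩ := exists_word hS g
  have := wordLength_le (S := S) (l.map fun x => x⁻¹).reverse (by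
    intro s hs
    simp only [List.mem_reverse, List.mem_map] at hs
    obtain ⟨t, ht, rfl⟩ := hs
    rw [inv_inv]
    exact (hl t ht).symm)
  rwa [← List.prod_inv_reverse, hg, List.length_reverse, List.length_map, hl'] at this

theorem wordLength_conj_inv_le (hS : Generates S) (g v : Γ) :
    wordLength S (g * v⁻¹ * g⁻¹) ≤ 2 * wordLength S g + wordLength S v := by
  have h1 := wordLength_mul_le hS (g * v⁻¹) g⁻¹
  have h2 := wordLength_mul_le hS g v⁻¹
  have h3 := wordLength_inv_le hS g
  have h4 := wordLength_inv_le hS v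
  omega

/-- Rapid decay comes with its own generating set, while the moment hypothesis is weighted by the
length for `S`; this comparison reconciles the two. -/
theorem exists_wordLength_le_mul (hS : Generates S) {S' : Finset Γ} (hS' : Generates S') :
    ∃ M : ℕ, 1 ≤ M ∧ ∀ g, wordLength S' g ≤ M * wordLength S g := by
  set M := S.sup (wordLength S') + 1
  refine ⟨M, by omega, fun g => ?_⟩
  obtain ⟨l, hl, hg, hl'⟩ := exists_word hS g
  rw [← hl', ← hg]
  clear hl' hg
  induction l with
  | nil => simp [wordLength_one]
  | cons s l ih =>
    have h1 := wordLength_mul_le hS' s l.prod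
    have h2 := ih fun t ht => hl t (List.mem_cons_of_mem _ ht)
    have h3 : wordLength S' s ≤ M := by
      rcases hl s List.mem_cons_self with h | h
      · have := Finset.le_sup (f := wordLength S') h
        omega
      · have h5 := Finset.le_sup (f := wordLength S') h
        have h6 := wordLength_inv_le hS' s⁻¹
        rw [inv_inv] at h6
        omega
    rw [List.prod_cons, List.length_cons, mul_add, mul_one]
    omega

/-- The support of `x` lies in the ball of radius `r` around the unit. -/
def SupportedInBall (S : Finset Γ) (r : ℕ) (x : MonoidAlgebra ℂ Γ) : Prop :=
  ∀ g, x.coeff g ≠ 0 → wordLength S g ≤ r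

theorem SupportedInBall.mono {r r' : ℕ} {x : MonoidAlgebra ℂ Γ} (hx : SupportedInBall S r x)
    (h : r ≤ r') : SupportedInBall S r' x := fun g hg => (hx g hg).trans h

theorem supportedInBall_one : SupportedInBall S 0 (1 : MonoidAlgebra ℂ Γ) := by
  classical
  intro g hg
  rw [MonoidAlgebra.one_def, MonoidAlgebra.coeff_single, Finsupp.single_apply] at hg
  by_cases h : 1 = g
  · rw [← h, wordLength_one]
  · simp [h] at hg

theorem SupportedInBall.smul {r : ℕ} {x : MonoidAlgebra ℂ Γ} (hx : SupportedInBall S r x)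
    (c : ℝ) : SupportedInBall S r (c • x) := by
  intro g hg
  refine hx g fun h => hg ?_
  simp [h]

theorem SupportedInBall.sum {ι : Type*} {s : Finset ι} {r : ℕ} {x : ι → MonoidAlgebra ℂ Γ}
    (hx : ∀ i ∈ s, SupportedInBall S r (x i)) : SupportedInBall S r (∑ i ∈ s, x i) := by
  intro g hg
  rw [MonoidAlgebra.coeff_sum, Finsupp.finsetSum_apply] at hg
  obtain ⟨i, hi, h⟩ := Finset.exists_ne_zero_of_sum_ne_zero hg
  exact hx i hi g h

theorem SupportedInBall.mul (hS : Generates S) {r r' : ℕ} {x y : MonoidAlgebra ℂ Γ}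
    (hx : SupportedInBall S r x) (hy : SupportedInBall S r' y) :
    SupportedInBall S (r + r') (x * y) := by
  classical
  intro g hg
  have := MonoidAlgebra.support_coeff_mul_subset x y (Finsupp.mem_support_iff.2 hg)
  obtain ⟨a, ha, b, hb, rfl⟩ := Finset.mem_mul.1 this
  exact (wordLength_mul_le hS a b).trans
    (add_le_add (hx a (Finsupp.mem_support_iff.1 ha)) (hy b (Finsupp.mem_support_iff.1 hb)))

theorem SupportedInBall.pow (hS : Generates S) {r : ℕ} {x : MonoidAlgebra ℂ Γ}
    (hx : SupportedInBall S r x) (k : ℕ) : SupportedInBall S (r * k) (x ^ k) := by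
  induction k with
  | zero => simpa using supportedInBall_one
  | succ k ih => rw [pow_succ, mul_add, mul_one]; exact ih.mul hS hx

theorem SupportedInBall.aeval (hS : Generates S) {r : ℕ} {x : MonoidAlgebra ℂ Γ}
    (hx : SupportedInBall S r x) (q : Polynomial ℝ) :
    SupportedInBall S (r * q.natDegree) (Polynomial.aeval x q) := by
  rw [Polynomial.aeval_eq_sum_range]
  refine SupportedInBall.sum fun i hi => ((hx.pow hS i).smul _).mono ?_
  have : i ≤ q.natDegree := by simpa [Nat.lt_succ_iff] using hi
  gcongr

theorem exists_supportedInBall (S : Finset Γ) (x : MonoidAlgebra ℂ Γ) :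
    ∃ r, SupportedInBall S r x :=
  ⟨x.coeff.support.sup (wordLength S), fun _ hg =>
    Finset.le_sup (f := wordLength S) (Finsupp.mem_support_iff.2 hg)⟩

end WordLength

/-! ### Neumann series for the Poisson kernel, for scalars and in C*-algebras -/

section Neumann

/-- Truncated Neumann series for the Poisson kernel `η / ((x - E)² + η²)`. -/
def neumannPoly (L E η : ℝ) (n : ℕ) : Polynomial ℝ :=
  Polynomial.C (η / (L ^ 2 + η ^ 2)) * ∑ k ∈ Finset.range n,
    (1 - Polynomial.C (L ^ 2 + η ^ 2)⁻¹ *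
      ((Polynomial.X - Polynomial.C E) ^ 2 + Polynomial.C (η ^ 2))) ^ k

theorem natDegree_neumannPoly_le (L E η : ℝ) (n : ℕ) :
    (neumannPoly L E η n).natDegree ≤ 2 * n := by
  unfold neumannPoly
  refine (Polynomial.natDegree_C_mul_le _ _).trans ?_
  refine Polynomial.natDegree_sum_le_of_forall_le _ _ fun k hk => ?_
  refine Polynomial.natDegree_pow_le.trans ?_
  have h : (1 - Polynomial.C (L ^ 2 + η ^ 2)⁻¹ *
      ((Polynomial.X - Polynomial.C E) ^ 2 + Polynomial.C (η ^ 2))).natDegree ≤ 2 := by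
    compute_degree
  have := Finset.mem_range.1 hk
  nlinarith

/-- The Poisson kernel `η / ((x - E)² + η²)`. -/
def poisson (E η x : ℝ) : ℝ := η / ((x - E) ^ 2 + η ^ 2)

theorem poisson_nonneg {η : ℝ} (hη : 0 < η) (E x : ℝ) : 0 ≤ poisson E η x := by
  unfold poisson; positivity

theorem poisson_le {η : ℝ} (hη : 0 < η) (E x : ℝ) : poisson E η x ≤ 1 / η := by
  unfold poisson
  rw [div_le_div_iff₀ (by positivity) hη]
  nlinarith [sq_nonneg (x - E)]

theorem eval_neumannPoly {L E η : ℝ} (hη : 0 < η) (n : ℕ) (x : ℝ) :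
    (neumannPoly L E η n).eval x =
      (1 - ((L ^ 2 - (x - E) ^ 2) / (L ^ 2 + η ^ 2)) ^ n) * poisson E η x := by
  have hB : L ^ 2 + η ^ 2 ≠ 0 := by positivity
  have hx : (x - E) ^ 2 + η ^ 2 ≠ 0 := by positivity
  have h1 : 1 - (L ^ 2 + η ^ 2)⁻¹ * ((x - E) ^ 2 + η ^ 2) =
      (L ^ 2 - (x - E) ^ 2) / (L ^ 2 + η ^ 2) := by
    field_simp; ring
  simp only [neumannPoly, Polynomial.eval_mul, Polynomial.eval_C, Polynomial.eval_finsetSum,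
    Polynomial.eval_pow, Polynomial.eval_sub, Polynomial.eval_one, Polynomial.eval_add,
    Polynomial.eval_X, h1]
  rw [← mul_neg_geom_sum, ← h1]
  unfold poisson
  field_simp
  ring

/-- For |x − E| ≤ L the ratio of the geometric series lies between 0 and L²/(L² + η²) < 1, so the
truncations approach the Poisson kernel from below. Positivity matters later: sums over windows are
extended to the whole spectrum. -/
theorem neumannPoly_bounds {L E η : ℝ} (hη : 0 < η) (n : ℕ) {x : ℝ} (hx : |x - E| ≤ L) :
    0 ≤ (neumannPoly L E η n).eval x ∧ (neumannPoly L E η n).eval x ≤ poisson E η x ∧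
      poisson E η x ≤ (neumannPoly L E η n).eval x + (L ^ 2 / (L ^ 2 + η ^ 2)) ^ n * (1 / η) := by
  rw [eval_neumannPoly hη]
  have hsq : (x - E) ^ 2 ≤ L ^ 2 := sq_le_sq' (by linarith [neg_abs_le (x - E)])
    ((le_abs_self _).trans hx)
  have hp := poisson_nonneg hη E x
  have hp' := poisson_le hη E x
  set t := (L ^ 2 - (x - E) ^ 2) / (L ^ 2 + η ^ 2)
  have ht0 : 0 ≤ t := div_nonneg (by linarith) (by positivity)
  have ht : t ≤ L ^ 2 / (L ^ 2 + η ^ 2) := by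
    have := sq_nonneg (x - E)
    simp only [t]; gcongr; linarith
  have ht1 : t ≤ 1 := ht.trans ((div_le_one (by positivity)).2 (by nlinarith))
  have h0 : 0 ≤ t ^ n := pow_nonneg ht0 n
  have h1 : t ^ n ≤ 1 := pow_le_one₀ ht0 ht1
  refine ⟨mul_nonneg (by linarith) hp, by nlinarith, ?_⟩
  have : t ^ n * poisson E η x ≤ (L ^ 2 / (L ^ 2 + η ^ 2)) ^ n * (1 / η) := by gcongr
  linarith

variable {A : Type*} [CStarAlgebra A]

theorem isUnit_sub_smul_of_isSelfAdjoint {a : A} (ha : IsSelfAdjoint a) {z : ℂ} (hz : z.im ≠ 0) :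
    IsUnit (a - z • (1 : A)) := by
  by_contra h
  have hm : z ∈ spectrum ℂ a := by
    rw [spectrum.mem_iff, Algebra.algebraMap_eq_smul_one]
    intro h'
    exact h (by simpa using h'.neg)
  have := ha.mem_spectrum_eq_re hm
  apply hz
  rw [this]
  simp

/-- Since (a − E)² + η² = (a − z)(a − z̄), multiplication by it cancels both resolvents and leaves
(z − z̄)/(2i) = η. This identifies Im R^z with the Poisson kernel of a. -/
theorem im_inverse_mul {a : A} (ha : IsSelfAdjoint a) (E : ℝ) {η : ℝ} (hη : 0 < η) :
    ((2 * Complex.I)⁻¹ • (Ring.inverse (a - ((E : ℂ) + η * Complex.I) • (1 : A)) -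
      star (Ring.inverse (a - ((E : ℂ) + η * Complex.I) • (1 : A))))) *
      ((a - E • 1) ^ 2 + (η ^ 2) • 1) = η • 1 := by
  set z : ℂ := (E : ℂ) + η * Complex.I with hz
  have hu : IsUnit (a - z • (1 : A)) := isUnit_sub_smul_of_isSelfAdjoint ha (by simp [hz, hη.ne'])
  set R := Ring.inverse (a - z • (1 : A))
  have hR : R * (a - z • 1) = 1 := Ring.inverse_mul_cancel _ hu
  have hR' : (a - z • 1) * R = 1 := Ring.mul_inverse_cancel _ hu
  have hs : star (a - z • (1 : A)) = a - (starRingEnd ℂ z) • 1 := by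
    rw [star_sub, star_smul, star_one, ha.star_eq]; rfl
  have hR2 : star R * (a - (starRingEnd ℂ z) • 1) = 1 := by
    rw [← hs, ← star_mul, hR', star_one]
  have e1 : (a - E • 1) ^ 2 + (η ^ 2) • 1 = (a - z • 1) * (a - (starRingEnd ℂ z) • 1) := by
    have hE : (E • (1 : A)) = (E : ℂ) • (1 : A) := by simp
    have hη2 : ((η ^ 2) • (1 : A)) = ((η : ℂ) ^ 2) • (1 : A) := by
      rw [← Complex.ofReal_pow, Complex.coe_smul]
    have hs1 : z + starRingEnd ℂ z = 2 * E := by simp [hz]; ring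
    have hs2 : z * starRingEnd ℂ z = (E : ℂ) ^ 2 + η ^ 2 := by
      simp [hz]; ring_nf; simp
    rw [hE, hη2]
    have r : (a - z • (1 : A)) * (a - (starRingEnd ℂ z) • 1) =
        a * a - (z + starRingEnd ℂ z) • a + (z * starRingEnd ℂ z) • 1 := by
      simp only [sub_mul, mul_sub, smul_mul_assoc, mul_smul_comm, one_mul, mul_one]
      module
    rw [r, hs1, hs2, sq]
    simp only [sub_mul, mul_sub, smul_mul_assoc, mul_smul_comm, one_mul, mul_one]
    module
  have e2 : (a - z • (1 : A)) * (a - (starRingEnd ℂ z) • 1) =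
      (a - (starRingEnd ℂ z) • 1) * (a - z • 1) := by
    simp only [sub_mul, mul_sub, smul_mul_assoc, mul_smul_comm, one_mul, mul_one]
    module
  rw [e1, smul_mul_assoc, sub_mul, ← mul_assoc, hR, one_mul, e2, ← mul_assoc, hR2, one_mul]
  have e3 : a - (starRingEnd ℂ z) • (1 : A) - (a - z • 1) = (z - starRingEnd ℂ z) • 1 := by
    rw [sub_smul]; abel
  rw [e3, smul_smul]
  have e4 : (2 * Complex.I)⁻¹ * (z - starRingEnd ℂ z) = (η : ℂ) := by
    have : (2 * Complex.I) ≠ 0 := by simp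
    field_simp
    simp [hz]; ring
  rw [e4]
  simp

theorem norm_sq_sub_sq_le [PartialOrder A] [StarOrderedRing A] {a : A} (ha : IsSelfAdjoint a)
    {L : ℝ} (hL : ‖a‖ ≤ L) : ‖(L ^ 2) • (1 : A) - a ^ 2‖ ≤ L ^ 2 := by
  have hL0 : 0 ≤ L := (norm_nonneg _).trans hL
  have h0 : 0 ≤ a ^ 2 := by
    rw [sq]; nth_rewrite 1 [← ha.star_eq]; exact star_mul_self_nonneg a
  have h1 : a ^ 2 ≤ algebraMap ℝ A (‖a‖ ^ 2) := by
    rw [sq]; nth_rewrite 1 [← ha.star_eq]; exact CStarAlgebra.star_mul_le_algebraMap_norm_sq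
  have h2 : algebraMap ℝ A (‖a‖ ^ 2) ≤ algebraMap ℝ A (L ^ 2) :=
    algebraMap_mono A (by gcongr)
  have h3 : 0 ≤ (L ^ 2) • (1 : A) - a ^ 2 := by
    rw [← Algebra.algebraMap_eq_smul_one]; exact sub_nonneg.2 (h1.trans h2)
  rw [CStarAlgebra.norm_le_iff_le_algebraMap _ (by positivity) h3,
    Algebra.algebraMap_eq_smul_one]
  exact sub_le_self _ h0

/-- With x the ratio of the series and q(1 − x) = η/B, the geometric sum telescopes to q − q xⁿ. The
order bound 0 ≤ L² − (a − E)² ≤ L² gives ‖x‖ ≤ L²/B. -/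
theorem aeval_neumannPoly [PartialOrder A] [StarOrderedRing A] {a q : A} (ha : IsSelfAdjoint a)
    {L E η : ℝ} (hη : 0 < η) (hL : ‖a - E • (1 : A)‖ ≤ L)
    (hq : q * ((a - E • 1) ^ 2 + (η ^ 2) • 1) = η • 1) (n : ℕ) :
    ‖Polynomial.aeval a (neumannPoly L E η n) - q‖ ≤
      ‖q‖ * ((L ^ 2 / (L ^ 2 + η ^ 2)) ^ n * ‖(1 : A)‖) := by
  have hL0 : 0 ≤ L := (norm_nonneg _).trans hL
  have hB : L ^ 2 + η ^ 2 ≠ 0 := by positivity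
  set B := L ^ 2 + η ^ 2 with hBdef
  set x : A := 1 - B⁻¹ • ((a - E • 1) ^ 2 + (η ^ 2) • 1) with hx
  have e1 : Polynomial.aeval a (neumannPoly L E η n) = (η / B) • ∑ k ∈ Finset.range n, x ^ k := by
    simp only [neumannPoly, map_mul, map_sum, map_pow, map_sub, map_one, map_add,
      Polynomial.aeval_X, Polynomial.aeval_C, Algebra.algebraMap_eq_smul_one, smul_mul_assoc,
      one_mul]
    simp only [hx, ← hBdef]
    congr! 6
    rw [← Algebra.algebraMap_eq_smul_one, ← Algebra.algebraMap_eq_smul_one, map_pow]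
  have e2 : q * (1 - x) = (η / B) • 1 := by
    rw [hx, sub_sub_cancel, mul_smul_comm, hq, smul_smul, div_eq_inv_mul]
  have e3 : Polynomial.aeval a (neumannPoly L E η n) = q - q * x ^ n := by
    rw [e1, ← one_mul (∑ k ∈ Finset.range n, x ^ k), ← smul_mul_assoc, ← e2, mul_assoc,
      mul_neg_geom_sum, mul_sub, mul_one]
  have e4 : x = B⁻¹ • ((L ^ 2) • (1 : A) - (a - E • 1) ^ 2) := by
    have : (1 : A) = B⁻¹ • (L ^ 2 + η ^ 2) • (1 : A) := by
      rw [smul_smul, ← hBdef, inv_mul_cancel₀ hB, one_smul]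
    rw [hx]
    nth_rewrite 1 [this]
    rw [← smul_sub]
    congr 1
    rw [add_smul]
    abel
  have hsa : IsSelfAdjoint (a - E • (1 : A)) := by
    refine ha.sub ?_
    rw [← Algebra.algebraMap_eq_smul_one]
    exact IsSelfAdjoint.algebraMap A (IsSelfAdjoint.all E)
  have e5 : ‖x‖ ≤ L ^ 2 / B := by
    rw [e4, norm_smul, Real.norm_of_nonneg (by positivity), div_eq_inv_mul]
    gcongr
    exact norm_sq_sub_sq_le hsa hL
  have e6 : ‖x ^ n‖ ≤ (L ^ 2 / B) ^ n * ‖(1 : A)‖ := by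
    rcases Nat.eq_zero_or_pos n with rfl | hn
    · simp
    · rcases subsingleton_or_nontrivial A with h | h
      · rw [Subsingleton.elim (x ^ n) 0, norm_zero]; positivity
      · rw [CStarRing.norm_one, mul_one]
        exact (norm_pow_le' x hn).trans (by gcongr)
  rw [e3, sub_sub_cancel_left, norm_neg]
  exact (norm_mul_le _ _).trans (by gcongr)

end Neumann

/-! ### Basis vectors and imaginary parts on ℓ²(Γ) -/

section EllTwo
variable {Γ : Type*}

open Classical in
theorem delta_apply (v w : Γ) : delta v w = if w = v then 1 else 0 := by
  unfold delta
  rw [lp.single_apply, Pi.single_apply]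

theorem norm_delta (v : Γ) : ‖delta v‖ = 1 := by
  classical
  unfold delta
  rw [lp.norm_single (by norm_num), norm_one]

theorem inner_delta_left (v : Γ) (f : EllTwo Γ) : inner ℂ (delta v) f = f v := by
  classical
  unfold delta
  rw [lp.inner_single_left]
  simp

theorem sum_norm_sq_le (f : EllTwo Γ) (s : Finset Γ) : ∑ u ∈ s, ‖f u‖ ^ 2 ≤ ‖f‖ ^ 2 := by
  have := lp.sum_rpow_le_norm_rpow (by norm_num) f s
  simpa using this

theorem adjoint_imOp (R : EllTwo Γ →L[ℂ] EllTwo Γ) :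
    ContinuousLinearMap.adjoint (imOp R) = imOp R := by
  unfold imOp
  rw [← ContinuousLinearMap.star_eq_adjoint, ← ContinuousLinearMap.star_eq_adjoint, star_smul,
    star_sub, star_star]
  have : star (2 * Complex.I)⁻¹ = -(2 * Complex.I)⁻¹ := by
    simp
  rw [this, neg_smul, ← smul_neg, neg_sub]

end EllTwo

/-! ### The regular representation and the resolvent column at the unit -/

section Regular
variable {Γ : Type*} [Group Γ]

theorem leftRegular_apply (g : Γ) (f : EllTwo Γ) (v : Γ) : leftRegular g f v = f (g⁻¹ * v) := rfl

theorem leftRegular_one : leftRegular (1 : Γ) = 1 := by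
  ext f v
  rw [leftRegular_apply, inv_one, one_mul]
  rfl

theorem leftRegular_mul (g h : Γ) : leftRegular (g * h) = leftRegular g * leftRegular h := by
  ext f v
  rw [mul_apply_eq_comp, leftRegular_apply, leftRegular_apply, leftRegular_apply,
    mul_inv_rev, mul_assoc]

theorem norm_leftRegular_apply (g : Γ) (f : EllTwo Γ) : ‖leftRegular g f‖ = ‖f‖ :=
  norm_translate g f

theorem norm_leftRegular_le (g : Γ) : ‖leftRegular g‖ ≤ 1 :=
  ContinuousLinearMap.opNorm_le_bound _ zero_le_one fun f => by
    rw [norm_leftRegular_apply, one_mul]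

theorem adjoint_leftRegular (g : Γ) :
    ContinuousLinearMap.adjoint (leftRegular g) = leftRegular g⁻¹ := by
  symm
  rw [ContinuousLinearMap.eq_adjoint_iff]
  intro x y
  rw [lp.inner_eq_tsum, lp.inner_eq_tsum]
  rw [← (Equiv.mulLeft g⁻¹).tsum_eq fun i => inner ℂ (leftRegular g⁻¹ x i) (y i)]
  refine tsum_congr fun v => ?_
  rw [leftRegular_apply, leftRegular_apply, Equiv.coe_mulLeft, inv_inv, mul_inv_cancel_left]

/-- The left regular representation of the group algebra. -/
def regularHom (Γ : Type*) [Group Γ] : MonoidAlgebra ℂ Γ →ₐ[ℂ] (EllTwo Γ →L[ℂ] EllTwo Γ) :=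
  MonoidAlgebra.lift ℂ _ Γ
    { toFun := leftRegular, map_one' := leftRegular_one, map_mul' := leftRegular_mul }

theorem regularHom_apply (x : MonoidAlgebra ℂ Γ) : regularHom Γ x = regularOp x := by
  rw [regularHom, MonoidAlgebra.lift_apply]; rfl

/-- The `ℓ¹` norm of an element of the group algebra. -/
def ellOneNorm (x : MonoidAlgebra ℂ Γ) : ℝ := ∑ g ∈ x.coeff.support, ‖x.coeff g‖

theorem regularOp_eq_sum (x : MonoidAlgebra ℂ Γ) :
    regularOp x = ∑ g ∈ x.coeff.support, x.coeff g • leftRegular g := rfl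

theorem norm_regularOp_le (x : MonoidAlgebra ℂ Γ) : ‖regularOp x‖ ≤ ellOneNorm x := by
  rw [regularOp_eq_sum]
  refine (norm_sum_le _ _).trans (Finset.sum_le_sum fun g _ => ?_)
  rw [norm_smul]
  exact mul_le_of_le_one_right (norm_nonneg _) (norm_leftRegular_le g)

theorem isSelfAdjoint_regularOp {p : MonoidAlgebra ℂ Γ} (hp : IsSymmetric p) :
    IsSelfAdjoint (regularOp p) := by
  rw [IsSelfAdjoint, regularOp_eq_sum, star_sum]
  refine Finset.sum_nbij' (fun g => g⁻¹) (fun g => g⁻¹) ?_ ?_ ?_ ?_ ?_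
  · intro g hg
    simpa [hp g] using hg
  · intro g hg
    simpa [hp g] using hg
  · simp
  · simp
  · intro g _
    rw [star_smul, hp g, ContinuousLinearMap.star_eq_adjoint, adjoint_leftRegular]
    rfl

theorem regularOp_delta_one_apply (x : MonoidAlgebra ℂ Γ) (u : Γ) :
    regularOp x (delta 1) u = x.coeff u := by
  classical
  rw [regularOp_eq_sum, _root_.sum_apply, lp.coeFn_sum, Finset.sum_apply]
  have : ∀ g ∈ x.coeff.support, (x.coeff g • leftRegular g) (delta 1) u =
      if u = g then x.coeff g else 0 := by
    intro g _
    rw [_root_.smul_apply, lp.coeFn_smul, Pi.smul_apply, leftRegular_apply,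
      delta_apply]
    by_cases h : u = g <;> simp [h, inv_mul_eq_one, eq_comm]
  rw [Finset.sum_congr rfl this, Finset.sum_ite_eq]
  split_ifs with h
  · rfl
  · exact (Finsupp.notMem_support_iff.1 h).symm

/-- The column of the imaginary part of the resolvent at the unit, as a function on `Γ`. -/
def resolventColumn (p : MonoidAlgebra ℂ Γ) (E η : ℝ) : EllTwo Γ :=
  imOp (resolventOp (regularOp p) (E + η * Complex.I)) (delta 1)

/-- The hypotheses concern the row at the unit, whereas λ(f) δ_e displays the coefficients of f as a
column. Self-adjointness of the imaginary part exchanges the two. -/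
theorem norm_imResolvent (p : MonoidAlgebra ℂ Γ) (E η : ℝ) (u : Γ) :
    ‖imResolvent p (E + η * Complex.I) 1 u‖ = ‖resolventColumn p E η u‖ := by
  unfold imResolvent entry resolventColumn
  rw [← inner_delta_left u, ← ContinuousLinearMap.adjoint_inner_left, adjoint_imOp,
    norm_inner_symm]

theorem imResolvent_one_one (p : MonoidAlgebra ℂ Γ) (E η : ℝ) :
    imResolvent p (E + η * Complex.I) 1 1 = resolventColumn p E η 1 := by
  unfold imResolvent entry resolventColumn
  rw [inner_delta_left]

theorem norm_aeval_neumannPoly_sub_resolventColumn_le {p : MonoidAlgebra ℂ Γ}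
    (hp : IsSymmetric p) (E : ℝ) {η : ℝ} (hη : 0 < η) :
    ∃ M : ℝ, 0 ≤ M ∧ ∃ θ : ℝ, 0 ≤ θ ∧ θ < 1 ∧
      (θ = (ellOneNorm p + |E|) ^ 2 / ((ellOneNorm p + |E|) ^ 2 + η ^ 2)) ∧
      ∀ n : ℕ, ‖regularOp (Polynomial.aeval p (neumannPoly (ellOneNorm p + |E|) E η n)) (delta 1) -
        resolventColumn p E η‖ ≤ M * θ ^ n := by
  set L := ellOneNorm p + |E|
  set Q := imOp (resolventOp (regularOp p) (E + η * Complex.I)) with hQ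
  have hsa := isSelfAdjoint_regularOp hp
  refine ⟨‖Q‖ * ‖(1 : EllTwo Γ →L[ℂ] EllTwo Γ)‖, by positivity, L ^ 2 / (L ^ 2 + η ^ 2),
    by positivity, ?_, rfl, fun n => ?_⟩
  · rw [div_lt_one (by positivity)]
    nlinarith
  · have hL : ‖regularOp p - E • (1 : EllTwo Γ →L[ℂ] EllTwo Γ)‖ ≤ L := by
      refine (norm_sub_le _ _).trans (add_le_add (norm_regularOp_le p) ?_)
      rw [norm_smul, Real.norm_eq_abs]
      exact mul_le_of_le_one_right (abs_nonneg _) ContinuousLinearMap.norm_id_le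
    have h := aeval_neumannPoly (q := Q) hsa hη hL (im_inverse_mul hsa E hη) n
    have h2 : regularOp (Polynomial.aeval p (neumannPoly L E η n)) =
        Polynomial.aeval (regularOp p) (neumannPoly L E η n) := by
      rw [← regularHom_apply, ← regularHom_apply]
      exact (Polynomial.aeval_algHom_apply ((regularHom Γ).restrictScalars ℝ) p _).symm
    rw [h2]
    unfold resolventColumn
    rw [← hQ, ← _root_.sub_apply]
    refine (ContinuousLinearMap.le_opNorm _ _).trans ?_
    rw [norm_delta, mul_one]
    refine h.trans (le_of_eq ?_)
    ring

end Regular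

/-! ### Polynomial approximation of the resolvent in weighted fourth moment -/

section Weights
variable {Γ : Type*} [Group Γ] {S : Finset Γ}

/-- The polynomial weight `(1 + |u|)^r` on the group. -/
def weight (S : Finset Γ) (r : ℝ) (u : Γ) : ℝ := (1 + (wordLength S u : ℝ)) ^ r

theorem weight_pos (r : ℝ) (u : Γ) : 0 < weight S r u := by unfold weight; positivity

/-- The weighted sum `∑ |f(u)|⁴ (1 + |u|)^r`. -/
def weightedFourth (S : Finset Γ) (r : ℝ) (f : MonoidAlgebra ℂ Γ) : ℝ :=
  ∑ u ∈ f.coeff.support, ‖f.coeff u‖ ^ 4 * weight S r u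

/-- The n-th truncation evaluated at p is supported in a ball of radius 2Dn, where the weight is
polynomial in n, and θⁿ beats it. The three bounds control, in order, the scalar error, the entry at
the unit and the weighted fourth moment. -/
theorem exists_neumann_degree {θ : ℝ} (h0 : 0 ≤ θ) (h1 : θ < 1) (M : ℝ) (D : ℕ)
    {r : ℝ} {η δ : ℝ} (hδ : 0 < δ) :
    ∃ n : ℕ, θ ^ n * (1 / η) ≤ δ ∧ M * θ ^ n ≤ δ ∧
      8 * ((1 + (D * (2 * n) : ℕ) : ℝ) ^ r * (M * θ ^ n) ^ 4) ≤ δ := by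
  obtain ⟨k, hk⟩ := exists_nat_ge r
  have t1 : Tendsto (fun n : ℕ => θ ^ n) atTop (𝓝 0) := tendsto_pow_atTop_nhds_zero_of_lt_one h0 h1
  have t2 : Tendsto (fun n : ℕ => (n : ℝ) ^ k * θ ^ n) atTop (𝓝 0) :=
    tendsto_pow_const_mul_const_pow_of_abs_lt_one k (by rwa [abs_of_nonneg h0])
  have e1 := (t1.mul_const (1 / η)).eventually_le_const (by simpa using hδ)
  have e2 := (t1.const_mul M).eventually_le_const (by simpa using hδ)
  have e3 := (t2.const_mul (8 * (1 + 2 * D : ℝ) ^ k * M ^ 4)).eventually_le_const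
    (by simpa using hδ)
  obtain ⟨n, h1', h2', h3', hn⟩ := (e1.and (e2.and (e3.and (eventually_ge_atTop 1)))).exists
  refine ⟨n, h1', h2', le_trans ?_ h3'⟩
  have hn' : (1 : ℝ) ≤ n := by exact_mod_cast hn
  have a1 : ((1 + (D * (2 * n) : ℕ) : ℝ) ^ r) ≤ (1 + 2 * D : ℝ) ^ k * (n : ℝ) ^ k := by
    refine (Real.rpow_le_rpow_of_exponent_le (by push_cast; linarith [show (0 : ℝ) ≤ D * (2 * n) by positivity]) hk).trans ?_
    rw [Real.rpow_natCast, ← mul_pow]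
    push_cast
    gcongr
    nlinarith [(Nat.cast_nonneg D : (0 : ℝ) ≤ D)]
  have a2 : (θ ^ n) ^ 4 ≤ θ ^ n :=
    pow_le_of_le_one (by positivity) (pow_le_one₀ h0 h1.le) (by norm_num)
  calc 8 * ((1 + (D * (2 * n) : ℕ) : ℝ) ^ r * (M * θ ^ n) ^ 4)
      = 8 * ((1 + (D * (2 * n) : ℕ) : ℝ) ^ r * (M ^ 4 * (θ ^ n) ^ 4)) := by rw [mul_pow]
    _ ≤ 8 * (((1 + 2 * D : ℝ) ^ k * (n : ℝ) ^ k) * (M ^ 4 * θ ^ n)) := by gcongr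
    _ = _ := by ring

/-- Polynomials approximating the Poisson kernel from below, whose values at the symbol approximate
the imaginary part of the resolvent in the weighted fourth moment. -/
theorem exists_poisson_approx (hS : Generates S) {p : MonoidAlgebra ℂ Γ} (hp : IsSymmetric p)
    {r : ℝ} (hr : 0 ≤ r) (E : ℝ) {η δ : ℝ} (hη : 0 < η) (hδ : 0 < δ) :
    ∃ q : Polynomial ℝ,
      (∀ x, |x| ≤ ellOneNorm p → 0 ≤ q.eval x ∧ q.eval x ≤ poisson E η x ∧
        poisson E η x ≤ q.eval x + δ) ∧
      ‖(Polynomial.aeval p q).coeff 1 - resolventColumn p E η 1‖ ≤ δ ∧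
      weightedFourth S r (Polynomial.aeval p q) ≤
        8 * (∑ u ∈ (Polynomial.aeval p q).coeff.support,
          ‖resolventColumn p E η u‖ ^ 4 * weight S r u) + δ := by
  obtain ⟨M, hM, θ, h0, h1, hθ, hn⟩ := norm_aeval_neumannPoly_sub_resolventColumn_le hp E hη
  obtain ⟨D, hD⟩ := exists_supportedInBall S p
  obtain ⟨n, n1, n2, n3⟩ := exists_neumann_degree h0 h1 M D (r := r) (η := η) hδ
  set q := neumannPoly (ellOneNorm p + |E|) E η n with hq
  set f := Polynomial.aeval p q with hf
  set v : EllTwo Γ := regularOp f (delta 1) - resolventColumn p E η with hv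
  have hvn : ‖v‖ ≤ M * θ ^ n := hn n
  have hvu : ∀ u, v u = f.coeff u - resolventColumn p E η u := fun u => by
    rw [hv, lp.coeFn_sub, Pi.sub_apply, regularOp_delta_one_apply]
  have hvle : ∀ u, ‖v u‖ ≤ ‖v‖ := fun u => lp.norm_apply_le_norm (by norm_num) v u
  refine ⟨q, fun x hx => ?_, ?_, ?_⟩
  · have := neumannPoly_bounds hη n (x := x) (E := E) (L := ellOneNorm p + |E|)
      ((abs_sub _ _).trans (by gcongr))
    refine ⟨this.1, this.2.1, this.2.2.trans ?_⟩
    rw [← hθ]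
    gcongr
  · rw [← hvu]
    exact ((hvle 1).trans hvn).trans n2
  · have hball : SupportedInBall S (D * (2 * n)) f :=
      (hD.aeval hS q).mono (by gcongr; exact natDegree_neumannPoly_le _ _ _ _)
    -- Writing ‖v u‖⁴ ≤ ‖v‖² ‖v u‖² lets the error sum to ‖v‖⁴ times the largest weight, so the size
    -- of the support, possibly exponential in n, never enters.
    have key : ∀ u ∈ f.coeff.support, ‖f.coeff u‖ ^ 4 * weight S r u ≤
        8 * (‖resolventColumn p E η u‖ ^ 4 * weight S r u) +
          8 * ((1 + (D * (2 * n) : ℕ) : ℝ) ^ r * (‖v‖ ^ 2 * ‖v u‖ ^ 2)) := by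
      intro u hu
      have hw : weight S r u ≤ (1 + (D * (2 * n) : ℕ) : ℝ) ^ r := by
        unfold weight
        have : wordLength S u ≤ D * (2 * n) := hball u (Finsupp.mem_support_iff.1 hu)
        gcongr
      have h1 : ‖f.coeff u‖ ≤ ‖resolventColumn p E η u‖ + ‖v u‖ := by
        have : f.coeff u = resolventColumn p E η u + v u := by rw [hvu]; ring
        rw [this]; exact norm_add_le _ _
      have h2 : ‖f.coeff u‖ ^ 4 ≤ 8 * (‖resolventColumn p E η u‖ ^ 4 + ‖v u‖ ^ 4) := by
        refine (pow_le_pow_left₀ (norm_nonneg _) h1 4).trans ?_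
        exact (add_pow_le (norm_nonneg _) (norm_nonneg _) 4).trans (by norm_num)
      have h3 : ‖v u‖ ^ 4 ≤ ‖v‖ ^ 2 * ‖v u‖ ^ 2 := by
        rw [show ‖v u‖ ^ 4 = ‖v u‖ ^ 2 * ‖v u‖ ^ 2 by ring]
        gcongr
        exact hvle u
      have hwp := (weight_pos (S := S) r u).le
      calc ‖f.coeff u‖ ^ 4 * weight S r u
          ≤ 8 * (‖resolventColumn p E η u‖ ^ 4 + ‖v u‖ ^ 4) * weight S r u := by gcongr
        _ = 8 * (‖resolventColumn p E η u‖ ^ 4 * weight S r u) +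
            8 * (weight S r u * ‖v u‖ ^ 4) := by ring
        _ ≤ _ := by gcongr
    unfold weightedFourth
    refine (Finset.sum_le_sum key).trans ?_
    rw [Finset.sum_add_distrib, ← Finset.mul_sum, ← Finset.mul_sum, ← Finset.mul_sum,
      ← Finset.mul_sum]
    gcongr
    refine le_trans ?_ n3
    gcongr
    calc ‖v‖ ^ 2 * ∑ u ∈ f.coeff.support, ‖v u‖ ^ 2 ≤ ‖v‖ ^ 2 * ‖v‖ ^ 2 := by
          gcongr; exact sum_norm_sq_le v _
      _ = ‖v‖ ^ 4 := by ring
      _ ≤ _ := by gcongr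

theorem norm_resolventColumn_one (p : MonoidAlgebra ℂ Γ) (E η : ℝ) :
    ‖resolventColumn p E η 1‖ = |(imResolvent p (E + η * Complex.I) 1 1).re| := by
  rw [imResolvent_one_one]
  have : starRingEnd ℂ (resolventColumn p E η 1) = resolventColumn p E η 1 := by
    unfold resolventColumn
    rw [← inner_delta_left, inner_conj_symm, ← ContinuousLinearMap.adjoint_inner_right,
      adjoint_imOp]
  obtain ⟨x, hx⟩ := Complex.conj_eq_iff_real.1 this
  rw [hx, Complex.norm_real, Complex.ofReal_re, Real.norm_eq_abs]

/-- Passing from |u|^r to (1 + |u|)^r costs 2^r away from the unit. At the unit, where |u|^r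
vanishes, the upper resolvent bound gives η² C₀⁴ → 0. -/
theorem eventually_sum_resolventColumn_le (hS : Generates S) {p : MonoidAlgebra ℂ Γ} {I₀ : Set ℝ}
    (hAC : TwoSidedResolventBound p I₀) {r : ℝ} (hr : 0 < r)
    (hdecay : ResolventFourthMomentDecay S p I₀ r) {ε : ℝ} (hε : 0 < ε) :
    ∀ᶠ η : ℝ in 𝓝[>] 0, ∀ E ∈ I₀, ∀ A : Finset Γ,
      η ^ 2 * ∑ u ∈ A, ‖resolventColumn p E η u‖ ^ 4 * weight S r u ≤ ε := by
  classical
  obtain ⟨C₀, hC₀, hAC⟩ := hAC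
  have hε' : 0 < ε / 2 / 2 ^ r := by positivity
  have e1 := Tendsto.eventually_le_const (u := ENNReal.ofReal (ε / 2 / 2 ^ r))
    (by simpa using hε') hdecay
  have t2 : Tendsto (fun η : ℝ => η ^ 2 * C₀ ^ 4) (𝓝[>] 0) (𝓝 0) := by
    have : Tendsto (fun η : ℝ => η ^ 2 * C₀ ^ 4) (𝓝 0) (𝓝 (0 ^ 2 * C₀ ^ 4)) :=
      ((continuous_id.pow 2).mul continuous_const).tendsto 0
    simp only [ne_eq, OfNat.ofNat_ne_zero, not_false_eq_true, zero_pow, zero_mul] at this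
    exact this.mono_left nhdsWithin_le_nhds
  have e2 := t2.eventually_le_const (half_pos hε)
  have e3 : ∀ᶠ η : ℝ in 𝓝[>] 0, η ∈ Set.Ioc (0 : ℝ) 1 := Ioc_mem_nhdsGT one_pos
  filter_upwards [e1, e2, e3] with η h1 h2 h3 E hE A
  have hF1 : ‖resolventColumn p E η 1‖ ≤ C₀ := by
    have := hAC E hE η h3.1 h3.2
    rw [norm_resolventColumn_one, abs_of_nonneg]
    · exact this.2
    · exact le_trans (by positivity) this.1
  have hw1 : weight S r (1 : Γ) = 1 := by simp [weight, wordLength_one]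
  have hne : η ^ 2 * ∑ u ∈ A.erase 1, ‖resolventColumn p E η u‖ ^ 4 * weight S r u ≤ ε / 2 := by
    have hs : ∑ u ∈ A.erase 1, η ^ 2 * ‖imResolvent p (E + η * Complex.I) 1 u‖ ^ 4 *
        (wordLength S u : ℝ) ^ r ≤ ε / 2 / 2 ^ r := by
      rw [← ENNReal.ofReal_le_ofReal_iff hε'.le, ENNReal.ofReal_sum_of_nonneg
        (fun _ _ => by positivity)]
      refine (ENNReal.sum_le_tsum _).trans (le_trans ?_ h1)
      exact le_iSup₂ (f := fun (E : ℝ) (_ : E ∈ I₀) => ∑' g : Γ, ENNReal.ofReal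
        (η ^ 2 * ‖imResolvent p (E + η * Complex.I) 1 g‖ ^ 4 * (wordLength S g : ℝ) ^ r)) E hE
    rw [le_div_iff₀ (by positivity)] at hs
    refine le_trans ?_ hs
    rw [Finset.mul_sum, Finset.sum_mul]
    refine Finset.sum_le_sum fun u hu => ?_
    rw [norm_imResolvent]
    have hu1 : 1 ≤ wordLength S u := by
      by_contra h
      exact Finset.ne_of_mem_erase hu (eq_one_of_wordLength_eq_zero hS (by omega))
    have hu1' : (1 : ℝ) ≤ wordLength S u := by exact_mod_cast hu1
    have : weight S r u ≤ (wordLength S u : ℝ) ^ r * 2 ^ r := by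
      unfold weight
      rw [← Real.mul_rpow (by positivity) (by positivity)]
      gcongr
      linarith
    calc η ^ 2 * (‖resolventColumn p E η u‖ ^ 4 * weight S r u)
        ≤ η ^ 2 * (‖resolventColumn p E η u‖ ^ 4 * ((wordLength S u : ℝ) ^ r * 2 ^ r)) := by gcongr
      _ = _ := by ring
  have h4 : ∑ u ∈ A, ‖resolventColumn p E η u‖ ^ 4 * weight S r u ≤
      ‖resolventColumn p E η 1‖ ^ 4 * weight S r 1 +
        ∑ u ∈ A.erase 1, ‖resolventColumn p E η u‖ ^ 4 * weight S r u := by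
    refine le_trans ?_ (Finset.sum_insert (f := fun u => ‖resolventColumn p E η u‖ ^ 4 *
      weight S r u) (Finset.notMem_erase 1 A)).le
    refine Finset.sum_le_sum_of_subset_of_nonneg (fun u hu => ?_)
      fun u _ _ => mul_nonneg (by positivity) (weight_pos r u).le
    by_cases h : u = 1 <;> simp [h, hu]
  calc η ^ 2 * ∑ u ∈ A, ‖resolventColumn p E η u‖ ^ 4 * weight S r u
      ≤ η ^ 2 * (C₀ ^ 4 * 1 +
        ∑ u ∈ A.erase 1, ‖resolventColumn p E η u‖ ^ 4 * weight S r u) := by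
        rw [hw1] at h4
        refine mul_le_mul_of_nonneg_left (h4.trans ?_) (by positivity)
        gcongr
    _ ≤ ε / 2 + ε / 2 := by
        rw [mul_add, mul_one]; exact add_le_add h2 hne
    _ = ε := by ring

theorem eventually_exists_approx (hS : Generates S) {p : MonoidAlgebra ℂ Γ} (hp : IsSymmetric p)
    {I₀ : Set ℝ} (hAC : TwoSidedResolventBound p I₀) {r : ℝ} (hr : 0 < r)
    (hdecay : ResolventFourthMomentDecay S p I₀ r) {ε : ℝ} (hε : 0 < ε) :
    ∀ᶠ η : ℝ in 𝓝[>] 0, ∀ E ∈ I₀, ∃ q : Polynomial ℝ,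
      (∀ x, |x| ≤ ellOneNorm p → 0 ≤ q.eval x) ∧
      (∀ x, |x| ≤ ellOneNorm p → |x - E| ≤ η → 1 ≤ 4 * η * q.eval x) ∧
      η ^ 2 * weightedFourth S r (Polynomial.aeval p q) ≤ ε := by
  filter_upwards [eventually_sum_resolventColumn_le hS hAC hr hdecay (ε := ε / 16) (by positivity),
    self_mem_nhdsWithin] with η h1 hη E hE
  have hη : 0 < η := hη
  -- The Poisson kernel is at least 1/(2η) on the window, and the first bound loses at most half of
  -- it; the second bound leaves ε/2 for the fourth moment, the other half being 8 · ε/16.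
  set δ := min (1 / (4 * η)) (ε / (2 * η ^ 2)) with hδdef
  have hδ : 0 < δ := by positivity
  obtain ⟨q, hq1, -, hq3⟩ := exists_poisson_approx hS hp hr.le E hη hδ
  refine ⟨q, fun x hx => (hq1 x hx).1, fun x hx hxE => ?_, ?_⟩
  · have h2 := (hq1 x hx).2.2
    have h3 : 1 / (2 * η) ≤ poisson E η x := by
      unfold poisson
      rw [div_le_div_iff₀ (by positivity) (by positivity)]
      have : (x - E) ^ 2 ≤ η ^ 2 := sq_le_sq' (by linarith [neg_abs_le (x - E)])
        ((le_abs_self _).trans hxE)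
      nlinarith
    have h4 : δ ≤ 1 / (4 * η) := min_le_left _ _
    have h5 : 1 / (2 * η) = 2 * (1 / (4 * η)) := by field_simp; norm_num
    have h6 : 1 / (4 * η) ≤ q.eval x := by linarith
    rwa [div_le_iff₀ (by positivity), mul_comm] at h6
  · have h2 := h1 E hE (Polynomial.aeval p q).coeff.support
    have h3 : η ^ 2 * δ ≤ ε / 2 := by
      calc η ^ 2 * δ ≤ η ^ 2 * (ε / (2 * η ^ 2)) := by gcongr; exact min_le_right _ _
        _ = ε / 2 := by field_simp
    have h4 := mul_le_mul_of_nonneg_left hq3 (sq_nonneg η)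
    linarith

end Weights

/-! ### Rapid decay in weighted form, and the pointwise product -/

section RapidDecayWeighted
variable {Γ : Type*} [Group Γ] {S : Finset Γ}

/-- The restriction of `x` to the sphere of radius `k`. -/
def spherePart (S : Finset Γ) (x : MonoidAlgebra ℂ Γ) (k : ℕ) : MonoidAlgebra ℂ Γ :=
  MonoidAlgebra.ofCoeff (x.coeff.filter fun u => wordLength S u = k)

theorem supportDiam_spherePart_le {S' : Finset Γ} (hS' : Generates S')
    {M : ℕ} (hM1 : 1 ≤ M) (hM : ∀ g, wordLength S' g ≤ M * wordLength S g)
    (x : MonoidAlgebra ℂ Γ) (k : ℕ) : supportDiam S' (spherePart S x k) ≤ 2 * M * (1 + k) := by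
  have hmem : ∀ g ∈ (spherePart S x k).coeff.support, wordLength S g = k := by
    intro g hg
    rw [spherePart, MonoidAlgebra.coeff_ofCoeff, Finsupp.support_filter] at hg
    exact (Finset.mem_filter.1 hg).2
  unfold supportDiam
  refine max_le (by nlinarith) (Finset.sup_le fun g hg => Finset.sup_le fun h hh => ?_)
  have h1 := wordLength_mul_le hS' h g⁻¹
  have h2 := wordLength_inv_le hS' g
  have h3 := hM g
  have h4 := hM h
  rw [hmem g hg] at h3
  rw [hmem h hh] at h4
  nlinarith

theorem sum_spherePart (x : MonoidAlgebra ℂ Γ) {N : ℕ} (hN : SupportedInBall S N x) :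
    ∑ k ∈ Finset.range (N + 1), spherePart S x k = x := by
  ext u
  rw [MonoidAlgebra.coeff_sum, Finsupp.finsetSum_apply]
  simp only [spherePart, MonoidAlgebra.coeff_ofCoeff, Finsupp.filter_apply]
  rw [Finset.sum_ite_eq]
  split_ifs with h
  · rfl
  · by_contra h'
    exact h (Finset.mem_range.2 (Nat.lt_succ_of_le (hN u (Ne.symm h'))))

/-- On the sphere of radius k, rapid decay costs (1 + k)^{C₁}. Cauchy–Schwarz over spheres then
requires the sum of (1 + k)^{2C₁ − r} to converge, which is where r > 2C₁ + 1 is used. -/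
theorem exists_norm_regularOp_le (hS : Generates S) {C₁ : ℝ} (hRD : RapidDecay Γ C₁) {r : ℝ}
    (hr : 2 * C₁ + 1 < r) :
    ∃ C : ℝ, 0 < C ∧ ∀ x : MonoidAlgebra ℂ Γ,
      ‖regularOp x‖ ≤ C * Real.sqrt (∑ u ∈ x.coeff.support, ‖x.coeff u‖ ^ 2 * weight S r u) := by
  classical
  obtain ⟨hC₁, S', hS', C, hC, hRD⟩ := hRD
  obtain ⟨M, hM1, hM⟩ := exists_wordLength_le_mul hS hS'
  set Z := ∑' k : ℕ, (1 + (k : ℝ)) ^ (2 * C₁ - r) with hZ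
  have hsum : Summable fun k : ℕ => (1 + (k : ℝ)) ^ (2 * C₁ - r) := by
    have := (summable_nat_add_iff 1).2 (Real.summable_nat_rpow.2 (show 2 * C₁ - r < -1 by linarith))
    refine this.congr fun k => ?_
    push_cast
    rw [add_comm]
  refine ⟨C * (2 * M : ℝ) ^ C₁ * (Real.sqrt Z + 1), by positivity, fun x => ?_⟩
  obtain ⟨N, hN⟩ := exists_supportedInBall S x
  set s : ℕ → ℝ := fun k => ∑ u ∈ x.coeff.support with wordLength S u = k, ‖x.coeff u‖ ^ 2 with hs
  have hs0 : ∀ k, 0 ≤ s k := fun k => Finset.sum_nonneg fun _ _ => by positivity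
  have h1 : ∀ k, ‖regularOp (spherePart S x k)‖ ≤
      C * (2 * M : ℝ) ^ C₁ * ((1 + (k : ℝ)) ^ C₁ * Real.sqrt (s k)) := by
    intro k
    have e : ∑ g ∈ (spherePart S x k).coeff.support, ‖(spherePart S x k).coeff g‖ ^ 2 = s k := by
      rw [spherePart, MonoidAlgebra.coeff_ofCoeff, Finsupp.support_filter]
      refine Finset.sum_congr rfl fun u hu => ?_
      rw [Finsupp.filter_apply, if_pos (Finset.mem_filter.1 hu).2]
    have hd : (supportDiam S' (spherePart S x k) : ℝ) ≤ 2 * M * (1 + k) := by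
      exact_mod_cast supportDiam_spherePart_le hS' hM1 hM x k
    calc ‖regularOp (spherePart S x k)‖
        ≤ C * (supportDiam S' (spherePart S x k) : ℝ) ^ C₁ * Real.sqrt (s k) := by
          rw [← e]; exact hRD _
      _ ≤ C * (2 * M * (1 + k) : ℝ) ^ C₁ * Real.sqrt (s k) := by gcongr
      _ = _ := by rw [Real.mul_rpow (by positivity) (by positivity)]; ring
  have h2 : ∑ k ∈ Finset.range (N + 1), (1 + (k : ℝ)) ^ C₁ * Real.sqrt (s k) ≤
      Real.sqrt Z * Real.sqrt (∑ u ∈ x.coeff.support, ‖x.coeff u‖ ^ 2 * weight S r u) := by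
    have e1 : ∀ k : ℕ, (1 + (k : ℝ)) ^ C₁ * Real.sqrt (s k) =
        Real.sqrt ((1 + (k : ℝ)) ^ (2 * C₁ - r)) * Real.sqrt ((1 + (k : ℝ)) ^ r * s k) := by
      intro k
      have hk : (0 : ℝ) < 1 + k := by positivity
      rw [← Real.sqrt_mul (by positivity), ← mul_assoc, ← Real.rpow_add hk, sub_add_cancel,
        Real.sqrt_mul (by positivity), mul_comm 2 C₁, Real.rpow_mul hk.le, Real.rpow_two,
        Real.sqrt_sq (by positivity)]
    rw [Finset.sum_congr rfl fun k _ => e1 k]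
    refine (Real.sum_sqrt_mul_sqrt_le _ (fun k => by positivity)
      (fun k => mul_nonneg (by positivity) (hs0 k))).trans ?_
    refine mul_le_mul (Real.sqrt_le_sqrt ?_) (Real.sqrt_le_sqrt (le_of_eq ?_))
      (Real.sqrt_nonneg _) (Real.sqrt_nonneg _)
    · exact hsum.sum_le_tsum _ fun _ _ => by positivity
    · rw [← Finset.sum_fiberwise_of_maps_to (s := x.coeff.support) (t := Finset.range (N + 1))
        (g := wordLength S)]
      · refine Finset.sum_congr rfl fun k _ => ?_
        rw [hs, Finset.mul_sum]
        refine Finset.sum_congr rfl fun u hu => ?_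
        rw [weight, (Finset.mem_filter.1 hu).2, mul_comm]
      · intro u hu
        exact Finset.mem_range.2 (Nat.lt_succ_of_le (hN u (Finsupp.mem_support_iff.1 hu)))
  calc ‖regularOp x‖ = ‖∑ k ∈ Finset.range (N + 1), regularOp (spherePart S x k)‖ := by
        conv_lhs => rw [← sum_spherePart x hN]
        simp only [← regularHom_apply, map_sum]
    _ ≤ ∑ k ∈ Finset.range (N + 1), ‖regularOp (spherePart S x k)‖ := norm_sum_le _ _
    _ ≤ ∑ k ∈ Finset.range (N + 1),
        C * (2 * M : ℝ) ^ C₁ * ((1 + (k : ℝ)) ^ C₁ * Real.sqrt (s k)) :=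
        Finset.sum_le_sum fun k _ => h1 k
    _ ≤ C * (2 * M : ℝ) ^ C₁ * (Real.sqrt Z *
        Real.sqrt (∑ u ∈ x.coeff.support, ‖x.coeff u‖ ^ 2 * weight S r u)) := by
        rw [← Finset.mul_sum]; gcongr
    _ ≤ C * (2 * M : ℝ) ^ C₁ * ((Real.sqrt Z + 1) *
        Real.sqrt (∑ u ∈ x.coeff.support, ‖x.coeff u‖ ^ 2 * weight S r u)) := by
        gcongr; linarith
    _ = _ := by ring

/-- The conjugate `g y g⁻¹` in the group algebra. -/
def conjBy (g : Γ) (y : MonoidAlgebra ℂ Γ) : MonoidAlgebra ℂ Γ :=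
  MonoidAlgebra.single g 1 * y * MonoidAlgebra.single g⁻¹ 1

theorem coeff_conjBy (g : Γ) (y : MonoidAlgebra ℂ Γ) (v : Γ) :
    (conjBy g y).coeff v = y.coeff (g⁻¹ * v * g) := by
  unfold conjBy
  rw [MonoidAlgebra.coeff_mul_single_apply, MonoidAlgebra.coeff_single_mul_apply]
  simp [mul_assoc]

/-- The pointwise product `u ↦ x(u) y(u⁻¹)`. -/
def hadamard (x y : MonoidAlgebra ℂ Γ) : MonoidAlgebra ℂ Γ :=
  ∑ u ∈ x.coeff.support, MonoidAlgebra.single u (x.coeff u * y.coeff u⁻¹)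

theorem coeff_hadamard (x y : MonoidAlgebra ℂ Γ) (u : Γ) :
    (hadamard x y).coeff u = x.coeff u * y.coeff u⁻¹ := by
  classical
  unfold hadamard
  rw [MonoidAlgebra.coeff_sum, Finsupp.finsetSum_apply]
  simp only [MonoidAlgebra.coeff_single, Finsupp.single_apply]
  rw [Finset.sum_ite_eq']
  split_ifs with h
  · rfl
  · rw [Finsupp.notMem_support_iff.1 h, zero_mul]

/-- The square of a product is at most the sum of the fourth powers. The map u ↦ g⁻¹u⁻¹g is
injective and changes 1 + |u| by a factor of at most 1 + 2|g|. -/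
theorem sum_hadamard_le (hS : Generates S) {r : ℝ} (hr : 0 ≤ r) (g : Γ)
    (x y : MonoidAlgebra ℂ Γ) :
    ∑ u ∈ (hadamard x (conjBy g y)).coeff.support,
        ‖(hadamard x (conjBy g y)).coeff u‖ ^ 2 * weight S r u ≤
      (1 + 2 * wordLength S g : ℝ) ^ r * (weightedFourth S r x + weightedFourth S r y) := by
  classical
  set c := (1 + 2 * wordLength S g : ℝ) ^ r
  have hc : 1 ≤ c := Real.one_le_rpow (by simp) hr
  set A := (hadamard x (conjBy g y)).coeff.support
  have hw0 : ∀ u : Γ, 0 ≤ weight S r u := fun u => (weight_pos r u).le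
  have hA : ∀ u ∈ A, x.coeff u ≠ 0 ∧ y.coeff (g⁻¹ * u⁻¹ * g) ≠ 0 := by
    intro u hu
    have := Finsupp.mem_support_iff.1 hu
    rw [coeff_hadamard, coeff_conjBy] at this
    exact ⟨left_ne_zero_of_mul this, right_ne_zero_of_mul this⟩
  have h1 : ∑ u ∈ A, ‖x.coeff u‖ ^ 4 * weight S r u ≤ weightedFourth S r x :=
    Finset.sum_le_sum_of_subset_of_nonneg (fun u hu => Finsupp.mem_support_iff.2 (hA u hu).1)
      fun u _ _ => mul_nonneg (by positivity) (hw0 u)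
  have h2 : ∑ u ∈ A, ‖y.coeff (g⁻¹ * u⁻¹ * g)‖ ^ 4 * weight S r u ≤ c * weightedFourth S r y := by
    have e : ∀ u ∈ A, ‖y.coeff (g⁻¹ * u⁻¹ * g)‖ ^ 4 * weight S r u ≤
        c * (‖y.coeff (g⁻¹ * u⁻¹ * g)‖ ^ 4 * weight S r (g⁻¹ * u⁻¹ * g)) := by
      intro u _
      have hw : weight S r u ≤ c * weight S r (g⁻¹ * u⁻¹ * g) := by
        unfold weight
        rw [← Real.mul_rpow (by positivity) (by positivity)]
        refine Real.rpow_le_rpow (by positivity) ?_ hr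
        have := wordLength_conj_inv_le hS g (g⁻¹ * u⁻¹ * g)
        have e : g * (g⁻¹ * u⁻¹ * g)⁻¹ * g⁻¹ = u := by group
        rw [e] at this
        have h' : (wordLength S u : ℝ) ≤ 2 * wordLength S g + wordLength S (g⁻¹ * u⁻¹ * g) := by
          exact_mod_cast this
        nlinarith [show (0 : ℝ) ≤ wordLength S g * wordLength S (g⁻¹ * u⁻¹ * g) by positivity]
      calc _ ≤ ‖y.coeff (g⁻¹ * u⁻¹ * g)‖ ^ 4 * (c * weight S r (g⁻¹ * u⁻¹ * g)) := by gcongr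
        _ = _ := by ring
    refine (Finset.sum_le_sum e).trans ?_
    rw [← Finset.mul_sum]
    gcongr
    have hinj : Set.InjOn (fun u : Γ => g⁻¹ * u⁻¹ * g) A := by
      intro u _ v _ h
      simpa using h
    rw [← Finset.sum_image (f := fun v => ‖y.coeff v‖ ^ 4 * weight S r v) hinj]
    refine Finset.sum_le_sum_of_subset_of_nonneg (fun v hv => ?_)
      fun u _ _ => mul_nonneg (by positivity) (hw0 u)
    obtain ⟨u, hu, rfl⟩ := Finset.mem_image.1 hv
    exact Finsupp.mem_support_iff.2 (hA u hu).2
  have h3 : ∀ u ∈ A, ‖(hadamard x (conjBy g y)).coeff u‖ ^ 2 * weight S r u ≤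
      ‖x.coeff u‖ ^ 4 * weight S r u + ‖y.coeff (g⁻¹ * u⁻¹ * g)‖ ^ 4 * weight S r u := by
    intro u _
    rw [coeff_hadamard, coeff_conjBy, norm_mul, ← add_mul]
    refine mul_le_mul_of_nonneg_right ?_ (hw0 u)
    nlinarith [sq_nonneg (‖x.coeff u‖ ^ 2 - ‖y.coeff (g⁻¹ * u⁻¹ * g)‖ ^ 2),
      sq_nonneg (‖x.coeff u‖ ^ 2), sq_nonneg (‖y.coeff (g⁻¹ * u⁻¹ * g)‖ ^ 2)]
  refine (Finset.sum_le_sum h3).trans ?_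
  rw [Finset.sum_add_distrib, mul_add]
  refine add_le_add (h1.trans ?_) h2
  exact le_mul_of_one_le_left (Finset.sum_nonneg fun u _ => mul_nonneg (by positivity) (hw0 u)) hc

end RapidDecayWeighted

/-! ### Permutation matrices and the trace expansion -/

section Finite
variable {Γ : Type*} [Group Γ] {n : ℕ}

theorem permMat_apply (σ : Equiv.Perm (Fin n)) (x y : Fin n) :
    permMat σ x y = if x = σ y then 1 else 0 := rfl

theorem permMat_one : permMat (1 : Equiv.Perm (Fin n)) = 1 := by
  ext x y
  rw [permMat_apply, Matrix.one_apply]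
  rfl

theorem permMat_mul (σ τ : Equiv.Perm (Fin n)) : permMat (σ * τ) = permMat σ * permMat τ := by
  ext x y
  rw [Matrix.mul_apply, Finset.sum_eq_single (τ y)]
  · rw [permMat_apply, permMat_apply, permMat_apply, if_pos rfl, mul_one]; rfl
  · intro z _ hz
    simp [permMat_apply, hz]
  · simp

theorem conjTranspose_permMat (σ : Equiv.Perm (Fin n)) :
    (permMat σ).conjTranspose = permMat σ⁻¹ := by
  ext x y
  rw [Matrix.conjTranspose_apply, permMat_apply, permMat_apply]
  by_cases h : y = σ x
  · simp [h]
  · rw [if_neg h, if_neg fun h' => h (by simp [h']), star_zero]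

/-- The permutation representation of the group algebra. -/
def permHom (ρ : Γ →* Equiv.Perm (Fin n)) :
    MonoidAlgebra ℂ Γ →ₐ[ℂ] Matrix (Fin n) (Fin n) ℂ :=
  MonoidAlgebra.lift ℂ _ Γ
    { toFun := fun g => permMat (ρ g)
      map_one' := by rw [map_one, permMat_one]
      map_mul' := fun g h => by rw [map_mul, permMat_mul] }

theorem permHom_apply (ρ : Γ →* Equiv.Perm (Fin n)) (x : MonoidAlgebra ℂ Γ) :
    permHom ρ x = permOp ρ x := by
  rw [permHom, MonoidAlgebra.lift_apply]; rfl

theorem permOp_apply (ρ : Γ →* Equiv.Perm (Fin n)) (f : MonoidAlgebra ℂ Γ) (x y : Fin n) :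
    permOp ρ f x y = ∑ u ∈ f.coeff.support, f.coeff u * if x = ρ u y then 1 else 0 := by
  unfold permOp Finsupp.sum
  rw [Matrix.sum_apply]
  rfl

theorem permOp_single (ρ : Γ →* Equiv.Perm (Fin n)) (g : Γ) (c : ℂ) :
    permOp ρ (MonoidAlgebra.single g c) = c • permMat (ρ g) := by
  rw [← permHom_apply, permHom, MonoidAlgebra.lift_single]; rfl

theorem permOp_conjBy (ρ : Γ →* Equiv.Perm (Fin n)) (g : Γ) (y : MonoidAlgebra ℂ Γ) :
    permOp ρ (conjBy g y) = permMat (ρ g) * permOp ρ y * permMat (ρ g⁻¹) := by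
  unfold conjBy
  rw [← permHom_apply, map_mul, map_mul, permHom_apply, permHom_apply, permHom_apply,
    permOp_single, permOp_single, one_smul, one_smul]

theorem permOp_aeval (ρ : Γ →* Equiv.Perm (Fin n)) (p : MonoidAlgebra ℂ Γ) (q : Polynomial ℝ) :
    permOp ρ (Polynomial.aeval p q) = Polynomial.aeval (permOp ρ p) q := by
  rw [← permHom_apply, ← permHom_apply]
  exact (Polynomial.aeval_algHom_apply ((permHom ρ).restrictScalars ℝ) p q).symm

theorem toEuclideanCLM_aeval_apply (A : Matrix (Fin n) (Fin n) ℂ) {v : EuclideanSpace ℂ (Fin n)}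
    {x : ℝ} (h : Matrix.toEuclideanCLM (𝕜 := ℂ) A v = (x : ℂ) • v) (q : Polynomial ℝ) :
    Matrix.toEuclideanCLM (𝕜 := ℂ) (Polynomial.aeval A q) v = ((q.eval x : ℝ) : ℂ) • v := by
  induction q using Polynomial.induction_on' with
  | add q₁ q₂ h₁ h₂ =>
    rw [map_add, map_add, _root_.add_apply, h₁, h₂, Polynomial.eval_add, Complex.ofReal_add,
      add_smul]
  | monomial k a =>
    rw [Polynomial.aeval_monomial, Algebra.algebraMap_eq_smul_one, smul_mul_assoc, one_mul,
      Polynomial.eval_monomial]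
    have hk : Matrix.toEuclideanCLM (𝕜 := ℂ) (A ^ k) v = ((x ^ k : ℝ) : ℂ) • v := by
      induction k with
      | zero => simp
      | succ k ih =>
        rw [pow_succ, map_mul, mul_apply_eq_comp, h, map_smul, ih, smul_smul, pow_succ,
          Complex.ofReal_mul, mul_comm]
    rw [← Complex.coe_smul, map_smul, _root_.smul_apply, hk, smul_smul, Complex.ofReal_mul]

theorem trace_eq_sum_matrixCoeff (φ : OrthonormalBasis (Fin n) ℂ (EuclideanSpace ℂ (Fin n)))
    (A : Matrix (Fin n) (Fin n) ℂ) : A.trace = ∑ α, matrixCoeff A (φ α) (φ α) := by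
  have h := LinearMap.trace_eq_sum_inner
    ((Matrix.toEuclideanCLM (𝕜 := ℂ) A : EuclideanSpace ℂ (Fin n) →L[ℂ] _) :
      EuclideanSpace ℂ (Fin n) →ₗ[ℂ] EuclideanSpace ℂ (Fin n)) φ
  have h' := LinearMap.trace_eq_sum_inner
    ((Matrix.toEuclideanCLM (𝕜 := ℂ) A : EuclideanSpace ℂ (Fin n) →L[ℂ] _) :
      EuclideanSpace ℂ (Fin n) →ₗ[ℂ] EuclideanSpace ℂ (Fin n)) (EuclideanSpace.basisFun (Fin n) ℂ)
  unfold matrixCoeff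
  refine Eq.trans ?_ h
  rw [h', Matrix.trace]
  refine Finset.sum_congr rfl fun i _ => ?_
  simp [EuclideanSpace.inner_single_left]

theorem toEuclideanCLM_mul_apply (A B : Matrix (Fin n) (Fin n) ℂ)
    (v : EuclideanSpace ℂ (Fin n)) :
    Matrix.toEuclideanCLM (𝕜 := ℂ) (A * B) v =
      Matrix.toEuclideanCLM (𝕜 := ℂ) A (Matrix.toEuclideanCLM (𝕜 := ℂ) B v) := by
  rw [map_mul, mul_apply_eq_comp]

theorem inner_conjTranspose (A : Matrix (Fin n) (Fin n) ℂ) (v w : EuclideanSpace ℂ (Fin n)) :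
    inner ℂ v (Matrix.toEuclideanCLM (𝕜 := ℂ) A.conjTranspose w) =
      inner ℂ (Matrix.toEuclideanCLM (𝕜 := ℂ) A v) w := by
  rw [← Matrix.star_eq_conjTranspose, map_star, ContinuousLinearMap.star_eq_adjoint,
    ContinuousLinearMap.adjoint_inner_right]

/-- The spectral expansion of `Tr(X* A X B)` when `A` and `B` are diagonal in the same basis. -/
theorem sum_eigen_eq_trace (φ : OrthonormalBasis (Fin n) ℂ (EuclideanSpace ℂ (Fin n)))
    {A B : Matrix (Fin n) (Fin n) ℂ} {a b : Fin n → ℝ}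
    (hA : ∀ β, Matrix.toEuclideanCLM (𝕜 := ℂ) A (φ β) = (a β : ℂ) • φ β)
    (hB : ∀ α, Matrix.toEuclideanCLM (𝕜 := ℂ) B (φ α) = (b α : ℂ) • φ α)
    (X : Matrix (Fin n) (Fin n) ℂ) :
    ((∑ α, ∑ β, a β * b α * ‖matrixCoeff X (φ β) (φ α)‖ ^ 2 : ℝ) : ℂ) =
      (X.conjTranspose * A * X * B).trace := by
  rw [trace_eq_sum_matrixCoeff φ, Complex.ofReal_sum]
  refine Finset.sum_congr rfl fun α _ => ?_
  unfold matrixCoeff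
  rw [toEuclideanCLM_mul_apply, hB, map_smul, toEuclideanCLM_mul_apply, toEuclideanCLM_mul_apply,
    inner_smul_right, inner_conjTranspose]
  set y := Matrix.toEuclideanCLM (𝕜 := ℂ) X (φ α)
  have hy : Matrix.toEuclideanCLM (𝕜 := ℂ) A y =
      ∑ β, (inner ℂ (φ β) y * (a β : ℂ)) • φ β := by
    conv_lhs => rw [← φ.sum_repr' y]
    rw [map_sum]
    refine Finset.sum_congr rfl fun β _ => ?_
    rw [map_smul, hA, smul_smul]
  rw [hy, inner_sum, Finset.mul_sum, Complex.ofReal_sum]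
  refine Finset.sum_congr rfl fun β _ => ?_
  rw [inner_smul_right, ← inner_conj_symm y (φ β)]
  have := Complex.mul_conj' (inner ℂ (φ β) y)
  push_cast
  rw [← this]
  ring

/-- Basis independence of the Hilbert–Schmidt norm; it controls the collision part in any
eigenbasis. -/
theorem sum_matrixCoeff_sq (φ : OrthonormalBasis (Fin n) ℂ (EuclideanSpace ℂ (Fin n)))
    (X : Matrix (Fin n) (Fin n) ℂ) :
    ∑ α, ∑ β, ‖matrixCoeff X (φ β) (φ α)‖ ^ 2 = ∑ x, ∑ y, ‖X x y‖ ^ 2 := by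
  have h := sum_eigen_eq_trace φ (A := 1) (B := 1) (a := 1) (b := 1) (by simp) (by simp) X
  have h2 : (X.conjTranspose * 1 * X * 1).trace = ((∑ x, ∑ y, ‖X x y‖ ^ 2 : ℝ) : ℂ) := by
    rw [Matrix.mul_one, Matrix.mul_one, Matrix.trace]
    simp only [Matrix.diag_apply, Matrix.mul_apply, Matrix.conjTranspose_apply]
    rw [Finset.sum_comm]
    push_cast
    refine Finset.sum_congr rfl fun x _ => Finset.sum_congr rfl fun y _ => ?_
    exact Complex.conj_mul' _
  rw [h2] at h
  simpa using Complex.ofReal_injective h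

/-- The number of fixed points of `g`. -/
def fixedCard (ρ : Γ →* Equiv.Perm (Fin n)) (g : Γ) : ℕ :=
  (Finset.univ.filter fun y => ρ g y = y).card

theorem trace_permMat (ρ : Γ →* Equiv.Perm (Fin n)) (g : Γ) :
    (permMat (ρ g)).trace = fixedCard ρ g := by
  unfold fixedCard
  rw [Matrix.trace, Finset.card_filter]
  push_cast
  refine Finset.sum_congr rfl fun y _ => ?_
  rw [Matrix.diag_apply, permMat_apply]
  simp only [eq_comm]

theorem trace_permOp (ρ : Γ →* Equiv.Perm (Fin n)) (f : MonoidAlgebra ℂ Γ) :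
    (permOp ρ f).trace = ∑ u ∈ f.coeff.support, f.coeff u * fixedCard ρ u := by
  unfold permOp Finsupp.sum
  rw [Matrix.trace_sum]
  refine Finset.sum_congr rfl fun u _ => ?_
  rw [Matrix.trace_smul, trace_permMat, smul_eq_mul]

theorem inner_permOp (ρ : Γ →* Equiv.Perm (Fin n)) (f : MonoidAlgebra ℂ Γ) (a : Fin n → ℂ) :
    inner ℂ (WithLp.toLp 2 a) (Matrix.toEuclideanCLM (𝕜 := ℂ) (permOp ρ f) (WithLp.toLp 2 a)) =
      ∑ u ∈ f.coeff.support, f.coeff u * ∑ y, starRingEnd ℂ (a (ρ u y)) * a y := by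
  rw [PiLp.inner_apply]
  have h : ∀ x, (Matrix.toEuclideanCLM (𝕜 := ℂ) (permOp ρ f) (WithLp.toLp 2 a)) x =
      ∑ y, permOp ρ f x y * a y := fun x => by
    rw [Matrix.toEuclideanCLM_toLp]; rfl
  simp only [h, permOp_apply, RCLike.inner_apply, Finset.sum_mul, Finset.mul_sum]
  rw [Finset.sum_comm]
  refine (Finset.sum_congr rfl fun y _ => Finset.sum_comm).trans ?_
  rw [Finset.sum_comm]
  refine Finset.sum_congr rfl fun u _ => Finset.sum_congr rfl fun y _ => ?_
  rw [Finset.sum_eq_single (ρ u y)]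
  · rw [if_pos rfl]; ring
  · intro x _ hx
    rw [if_neg hx]; ring
  · simp

/-- The observable `D_a ρ(g)`, where `D_a` is the multiplication by the function `a`. -/
def twisted (ρ : Γ →* Equiv.Perm (Fin n)) (a : Fin n → ℂ) (g : Γ) : Matrix (Fin n) (Fin n) ℂ :=
  Matrix.diagonal a * permMat (ρ g)

/-- Cyclicity of the trace moves ρ(g) onto f₂, which becomes its conjugate. What remains is a sum
over closed two-step walks y → u.y → vu.y = y. -/
theorem trace_twisted (ρ : Γ →* Equiv.Perm (Fin n)) (a : Fin n → ℂ) (g : Γ)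
    (f₁ f₂ : MonoidAlgebra ℂ Γ) :
    ((twisted ρ a g).conjTranspose * permOp ρ f₁ * twisted ρ a g * permOp ρ f₂).trace =
      ∑ u ∈ f₁.coeff.support, ∑ v ∈ (conjBy g f₂).coeff.support,
        f₁.coeff u * (conjBy g f₂).coeff v *
          ∑ y, if ρ (v * u) y = y then starRingEnd ℂ (a (ρ u y)) * a y else 0 := by
  have h1 : ((twisted ρ a g).conjTranspose * permOp ρ f₁ * twisted ρ a g * permOp ρ f₂).trace =
      (Matrix.diagonal (star a) * permOp ρ f₁ * Matrix.diagonal a *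
        permOp ρ (conjBy g f₂)).trace := by
    rw [permOp_conjBy, twisted, Matrix.conjTranspose_mul, conjTranspose_permMat, ← map_inv,
      Matrix.diagonal_conjTranspose]
    simp only [Matrix.mul_assoc]
    rw [Matrix.trace_mul_comm]
    simp only [Matrix.mul_assoc]
  rw [h1, Matrix.trace]
  have h2 : ∀ x, (Matrix.diagonal (star a) * permOp ρ f₁ * Matrix.diagonal a *
        permOp ρ (conjBy g f₂)).diag x = ∑ y, ∑ u ∈ f₁.coeff.support,
        ∑ v ∈ (conjBy g f₂).coeff.support, f₁.coeff u * (conjBy g f₂).coeff v *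
          (if x = ρ u y then (if ρ v x = y then starRingEnd ℂ (a x) * a y else 0) else 0) := by
    intro x
    rw [Matrix.diag_apply, Matrix.mul_apply]
    refine Finset.sum_congr rfl fun y _ => ?_
    rw [Matrix.mul_diagonal, Matrix.diagonal_mul, permOp_apply, permOp_apply,
      show ∀ s P b Q : ℂ, s * P * b * Q = P * Q * (s * b) from fun _ _ _ _ => by ring,
      Finset.sum_mul_sum, Finset.sum_mul]
    refine Finset.sum_congr rfl fun u _ => ?_
    rw [Finset.sum_mul]
    refine Finset.sum_congr rfl fun v _ => ?_
    by_cases hx : x = ρ u y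
    · by_cases hy : y = ρ v x
      · rw [if_pos hx, if_pos hy, if_pos hx, if_pos hy.symm, Pi.star_apply, RCLike.star_def]
        ring
      · rw [if_pos hx, if_neg hy, if_pos hx, if_neg (Ne.symm hy)]
        ring
    · rw [if_neg hx, if_neg hx]
      ring
  rw [Finset.sum_congr rfl fun x _ => h2 x, Finset.sum_comm]
  refine (Finset.sum_congr rfl fun y _ => Finset.sum_comm).trans ?_
  rw [Finset.sum_comm]
  refine Finset.sum_congr rfl fun u _ => ?_
  refine (Finset.sum_congr rfl fun y _ => Finset.sum_comm).trans ?_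
  rw [Finset.sum_comm]
  refine Finset.sum_congr rfl fun v _ => ?_
  rw [Finset.mul_sum]
  refine Finset.sum_congr rfl fun y _ => ?_
  rw [Finset.sum_eq_single (ρ u y)]
  · rw [if_pos rfl, map_mul, Equiv.Perm.mul_apply]
  · intro x _ hx
    rw [if_neg hx, mul_zero]
  · simp

open Classical in
/-- The contribution of the non-free points to `Tr(X* ρ(x) X ρ(y))`. -/
def nonfreeError (ρ : Γ →* Equiv.Perm (Fin n)) (x y : MonoidAlgebra ℂ Γ) : ℝ :=
  ∑ u ∈ x.coeff.support, ∑ v ∈ y.coeff.support.erase u⁻¹,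
    ‖x.coeff u‖ * ‖y.coeff v‖ * (4 * fixedCard ρ (v * u))

theorem inner_permOp_hadamard (ρ : Γ →* Equiv.Perm (Fin n)) (x y : MonoidAlgebra ℂ Γ)
    (a : Fin n → ℂ) :
    inner ℂ (WithLp.toLp 2 a)
        (Matrix.toEuclideanCLM (𝕜 := ℂ) (permOp ρ (hadamard x y)) (WithLp.toLp 2 a)) =
      ∑ u ∈ x.coeff.support, x.coeff u * y.coeff u⁻¹ *
        ∑ z, starRingEnd ℂ (a (ρ u z)) * a z := by
  rw [inner_permOp]
  simp only [coeff_hadamard]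
  refine Finset.sum_subset (fun u hu => ?_) fun u _ hu => ?_
  · rw [Finsupp.mem_support_iff, coeff_hadamard] at hu
    exact Finsupp.mem_support_iff.2 (left_ne_zero_of_mul hu)
  · rw [Finsupp.notMem_support_iff, coeff_hadamard] at hu
    rw [hu, zero_mul]

/-- For v = u⁻¹ the walk closes at every point, and these terms form the quadratic form. Any other
pair closes only at fixed points of vu, each contributing at most 2 · 2 = 4. -/
theorem norm_trace_twisted_sub_le (ρ : Γ →* Equiv.Perm (Fin n)) {a : Fin n → ℂ}
    (ha : ∀ x, ‖a x‖ ≤ 2) (g : Γ) (f₁ f₂ : MonoidAlgebra ℂ Γ) :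
    ‖((twisted ρ a g).conjTranspose * permOp ρ f₁ * twisted ρ a g * permOp ρ f₂).trace -
      inner ℂ (WithLp.toLp 2 a) (Matrix.toEuclideanCLM (𝕜 := ℂ)
        (permOp ρ (hadamard f₁ (conjBy g f₂))) (WithLp.toLp 2 a))‖ ≤
      nonfreeError ρ f₁ (conjBy g f₂) := by
  classical
  rw [trace_twisted, inner_permOp_hadamard, ← Finset.sum_sub_distrib]
  set y := conjBy g f₂
  unfold nonfreeError
  refine (norm_sum_le _ _).trans (Finset.sum_le_sum fun u _ => ?_)
  set G : Γ → ℂ := fun v => f₁.coeff u * y.coeff v *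
    ∑ z, if ρ (v * u) z = z then starRingEnd ℂ (a (ρ u z)) * a z else 0 with hG
  have h1 : G u⁻¹ = f₁.coeff u * y.coeff u⁻¹ * ∑ z, starRingEnd ℂ (a (ρ u z)) * a z := by
    simp [hG]
  have h2 : ∑ v ∈ y.coeff.support, G v - G u⁻¹ = ∑ v ∈ y.coeff.support.erase u⁻¹, G v := by
    by_cases hu : u⁻¹ ∈ y.coeff.support
    · rw [← Finset.add_sum_erase _ _ hu]; ring
    · have : G u⁻¹ = 0 := by simp [hG, Finsupp.notMem_support_iff.1 hu]
      rw [Finset.erase_eq_of_notMem hu, this, sub_zero]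
  rw [← h1, h2]
  refine (norm_sum_le _ _).trans (Finset.sum_le_sum fun v _ => ?_)
  rw [hG]
  dsimp only
  rw [norm_mul, norm_mul]
  refine mul_le_mul_of_nonneg_left ?_ (by positivity)
  rw [← Finset.sum_filter]
  refine (norm_sum_le_of_le (n := fun _ => (4 : ℝ)) _ fun z _ => ?_).trans (le_of_eq ?_)
  · rw [norm_mul, RCLike.norm_conj]
    nlinarith [ha (ρ u z), ha z, norm_nonneg (a z), norm_nonneg (a (ρ u z))]
  · rw [Finset.sum_const, nsmul_eq_mul, mul_comm]
    rfl

/-- This is where centring by ⟨K⟩ is needed: a must lie in 1^⊥, the only space on which strong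
convergence controls the norm. -/
theorem norm_inner_toEuclideanCLM_le {a : Fin n → ℂ}
    (ha : ∀ x, ‖a x‖ ≤ 2) (ha0 : ∑ x, a x = 0) (A : Matrix (Fin n) (Fin n) ℂ) :
    ‖inner ℂ (WithLp.toLp 2 a) (Matrix.toEuclideanCLM (𝕜 := ℂ) A (WithLp.toLp 2 a))‖ ≤
      4 * n * normOnOnesPerp A := by
  set v : EuclideanSpace ℂ (Fin n) := WithLp.toLp 2 a
  have hv : v ∈ (Submodule.span ℂ {onesVec n})ᗮ := by
    rw [Submodule.mem_orthogonal_singleton_iff_inner_right, PiLp.inner_apply]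
    simpa [onesVec, v] using ha0
  have h1 : ‖Matrix.toEuclideanCLM (𝕜 := ℂ) A v‖ ≤ normOnOnesPerp A * ‖v‖ :=
    ContinuousLinearMap.le_opNorm
      ((Matrix.toEuclideanCLM (𝕜 := ℂ) A).comp (Submodule.span ℂ {onesVec n})ᗮ.subtypeL) ⟨v, hv⟩
  have h2 : ‖v‖ ^ 2 ≤ 4 * n := by
    rw [EuclideanSpace.norm_sq_eq]
    refine (Finset.sum_le_card_nsmul _ _ 4 fun x _ => ?_).trans (le_of_eq ?_)
    · have := ha x
      have h0 := norm_nonneg (a x)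
      change ‖a x‖ ^ 2 ≤ 4
      nlinarith
    · simp [mul_comm]
  have h3 : 0 ≤ normOnOnesPerp A := by unfold normOnOnesPerp; positivity
  calc _ ≤ ‖v‖ * ‖Matrix.toEuclideanCLM (𝕜 := ℂ) A v‖ := norm_inner_le_norm _ _
    _ ≤ ‖v‖ * (normOnOnesPerp A * ‖v‖) := by gcongr
    _ = ‖v‖ ^ 2 * normOnOnesPerp A := by ring
    _ ≤ _ := by gcongr

end Finite

/-! ### Splitting a local observable into mean, centred and collision parts -/

section Decomposition
variable {Γ : Type*} [Group Γ] {n : ℕ}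

/-- The coefficients of a `T`-local observable. -/
def localCoeff (ρ : Γ →* Equiv.Perm (Fin n)) (K : Matrix (Fin n) (Fin n) ℂ) (g : Γ)
    (x : Fin n) : ℂ := K x (ρ g⁻¹ x)

/-- The mean value of the coefficient of `g`. -/
def localMean (ρ : Γ →* Equiv.Perm (Fin n)) (K : Matrix (Fin n) (Fin n) ℂ) (g : Γ) : ℂ :=
  (1 / (n : ℂ)) * ∑ x, K (ρ g x) x

/-- The centered coefficients of a `T`-local observable. -/
def centeredCoeff (ρ : Γ →* Equiv.Perm (Fin n)) (K : Matrix (Fin n) (Fin n) ℂ) (g : Γ)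
    (x : Fin n) : ℂ := localCoeff ρ K g x - localMean ρ K g

theorem sum_localCoeff (ρ : Γ →* Equiv.Perm (Fin n)) (K : Matrix (Fin n) (Fin n) ℂ) (g : Γ) :
    ∑ x, localCoeff ρ K g x = ∑ x, K (ρ g x) x := by
  unfold localCoeff
  rw [← Equiv.sum_comp (ρ g)]
  simp

theorem sum_centeredCoeff (ρ : Γ →* Equiv.Perm (Fin n)) (K : Matrix (Fin n) (Fin n) ℂ) (g : Γ) :
    ∑ x, centeredCoeff ρ K g x = 0 := by
  unfold centeredCoeff
  rw [Finset.sum_sub_distrib, sum_localCoeff, Finset.sum_const, Finset.card_univ,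
    Fintype.card_fin, nsmul_eq_mul, localMean]
  rcases Nat.eq_zero_or_pos n with rfl | hn
  · simp
  · have : (n : ℂ) ≠ 0 := by exact_mod_cast hn.ne'
    field_simp
    ring

theorem norm_centeredCoeff_le (ρ : Γ →* Equiv.Perm (Fin n)) {K : Matrix (Fin n) (Fin n) ℂ}
    (hK : ∀ x y, ‖K x y‖ ≤ 1) (g : Γ) (x : Fin n) : ‖centeredCoeff ρ K g x‖ ≤ 2 := by
  have h1 : ‖localMean ρ K g‖ ≤ 1 := by
    unfold localMean
    have : ‖∑ x, K (ρ g x) x‖ ≤ n := by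
      refine (norm_sum_le_of_le (n := fun _ => (1 : ℝ)) _ fun x _ => hK _ _).trans ?_
      simp
    rw [norm_mul, norm_div, norm_one, Complex.norm_natCast, one_div]
    refine (mul_le_mul_of_nonneg_left this (by positivity)).trans ?_
    exact inv_mul_le_one
  calc _ ≤ ‖localCoeff ρ K g x‖ + ‖localMean ρ K g‖ := norm_sub_le _ _
    _ ≤ 1 + 1 := add_le_add (hK _ _) h1
    _ = 2 := by norm_num

theorem average_eq (ρ : Γ →* Equiv.Perm (Fin n)) (T : Finset Γ) (K : Matrix (Fin n) (Fin n) ℂ) :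
    average ρ T K = ∑ g ∈ T, localMean ρ K g • permMat (ρ g) := by
  unfold average
  rw [← permHom_apply, map_sum]
  refine Finset.sum_congr rfl fun g _ => ?_
  rw [permHom_apply, permOp_single]
  rfl

/-- The part of the observable due to multiple edges. -/
def collisionPart (ρ : Γ →* Equiv.Perm (Fin n)) (T : Finset Γ) (K : Matrix (Fin n) (Fin n) ℂ) :
    Matrix (Fin n) (Fin n) ℂ :=
  K - average ρ T K - ∑ g ∈ T, twisted ρ (centeredCoeff ρ K g) g

/-- The sum over g ∈ T counts K(x, y) once for every g with x = g.y, so the defect is one minus this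
multiplicity. -/
theorem collisionPart_apply (ρ : Γ →* Equiv.Perm (Fin n)) (T : Finset Γ)
    (K : Matrix (Fin n) (Fin n) ℂ) (x y : Fin n) :
    collisionPart ρ T K x y = (1 - ((T.filter fun g => x = ρ g y).card : ℂ)) * K x y := by
  unfold collisionPart
  rw [average_eq, Matrix.sub_apply, Matrix.sub_apply, Matrix.sum_apply, Matrix.sum_apply, sub_sub,
    ← Finset.sum_add_distrib]
  have : ∀ g ∈ T, (localMean ρ K g • permMat (ρ g)) x y +
      twisted ρ (centeredCoeff ρ K g) g x y = if x = ρ g y then K x y else 0 := by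
    intro g _
    rw [twisted, Matrix.diagonal_mul, Matrix.smul_apply, permMat_apply, smul_eq_mul, ← add_mul,
      centeredCoeff, add_sub_cancel, localCoeff]
    by_cases h : x = ρ g y
    · rw [if_pos h, if_pos h, mul_one, h]; simp
    · rw [if_neg h, if_neg h, mul_zero]
  rw [Finset.sum_congr rfl this, ← Finset.sum_filter, Finset.sum_const, nsmul_eq_mul]
  ring

-- Multiplicity one gives no defect, and multiplicity zero gives K(x, y) = 0 by locality. Otherwise
-- x = g.y = h.y with g ≠ h, so h⁻¹g fixes y.
open Classical in
theorem sum_norm_collisionPart_le (ρ : Γ →* Equiv.Perm (Fin n)) {T : Finset Γ}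
    {K : Matrix (Fin n) (Fin n) ℂ} (hloc : IsLocal ρ T K) (hK : ∀ x y, ‖K x y‖ ≤ 1) :
    ∑ x, ∑ y, ‖collisionPart ρ T K x y‖ ^ 2 ≤
      (T.card : ℝ) ^ 2 * ∑ g ∈ T, ∑ h ∈ T.erase g, (fixedCard ρ (h⁻¹ * g) : ℝ) := by
  have h1 : ∀ x y, ‖collisionPart ρ T K x y‖ ^ 2 ≤ (T.card : ℝ) ^ 2 *
      ∑ g ∈ T, ∑ h ∈ T.erase g, if x = ρ g y ∧ x = ρ h y then 1 else 0 := by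
    intro x y
    have hnn : (0 : ℝ) ≤ ∑ g ∈ T, ∑ h ∈ T.erase g, if x = ρ g y ∧ x = ρ h y then 1 else 0 :=
      Finset.sum_nonneg fun _ _ => Finset.sum_nonneg fun _ _ => by split_ifs <;> norm_num
    rw [collisionPart_apply]
    set F := T.filter fun g => x = ρ g y with hF
    rcases Nat.lt_trichotomy F.card 1 with h | h | h
    · have hz : K x y = 0 := hloc x y (by
        rintro ⟨g, hg, hx⟩
        have : g ∈ F := Finset.mem_filter.2 ⟨hg, hx⟩
        rw [Finset.card_eq_zero.1 (Nat.lt_one_iff.1 h)] at this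
        simp at this)
      rw [hz, mul_zero, norm_zero, zero_pow two_ne_zero]
      positivity
    · rw [h]
      rw [Nat.cast_one, sub_self, zero_mul, norm_zero, zero_pow two_ne_zero]
      positivity
    · obtain ⟨g, hg, h', hh, hne⟩ := Finset.one_lt_card.1 h
      have hg' := Finset.mem_filter.1 hg
      have hh' := Finset.mem_filter.1 hh
      have h2 : (1 : ℝ) ≤ ∑ g ∈ T, ∑ h ∈ T.erase g, if x = ρ g y ∧ x = ρ h y then 1 else 0 := by
        calc (1 : ℝ) = if x = ρ g y ∧ x = ρ h' y then 1 else 0 := by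
              rw [if_pos ⟨hg'.2, hh'.2⟩]
          _ ≤ ∑ h ∈ T.erase g, if x = ρ g y ∧ x = ρ h y then (1 : ℝ) else 0 :=
              Finset.single_le_sum (f := fun h => if x = ρ g y ∧ x = ρ h y then (1 : ℝ) else 0)
                (fun _ _ => by split_ifs <;> norm_num)
                (Finset.mem_erase.2 ⟨hne.symm, hh'.1⟩)
          _ ≤ _ := Finset.single_le_sum (f := fun g => ∑ h ∈ T.erase g,
                if x = ρ g y ∧ x = ρ h y then (1 : ℝ) else 0)
                (fun _ _ => Finset.sum_nonneg fun _ _ => by split_ifs <;> norm_num) hg'.1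
      have h3 : ‖(1 - (F.card : ℂ)) * K x y‖ ≤ T.card := by
        rw [norm_mul]
        have e : ‖(1 : ℂ) - F.card‖ ≤ T.card := by
          rw [show (1 : ℂ) - F.card = ((1 - (F.card : ℝ) : ℝ) : ℂ) by push_cast; rfl,
            Complex.norm_real, Real.norm_eq_abs, abs_le]
          have e1 : (F.card : ℝ) ≤ T.card := by exact_mod_cast Finset.card_filter_le _ _
          have e2 : (1 : ℝ) ≤ F.card := by exact_mod_cast h.le
          constructor <;> linarith
        calc _ ≤ (T.card : ℝ) * 1 := mul_le_mul e (hK x y) (norm_nonneg _) (by positivity)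
          _ = _ := mul_one _
      calc _ ≤ (T.card : ℝ) ^ 2 := by gcongr
        _ ≤ _ := le_mul_of_one_le_right (by positivity) h2
  refine (Finset.sum_le_sum fun x _ => Finset.sum_le_sum fun y _ => h1 x y).trans (le_of_eq ?_)
  simp only [← Finset.mul_sum]
  congr 1
  rw [Finset.sum_comm]
  refine (Finset.sum_congr rfl fun y _ => Finset.sum_comm).trans ?_
  rw [Finset.sum_comm]
  refine Finset.sum_congr rfl fun g _ => ?_
  refine (Finset.sum_congr rfl fun y _ => Finset.sum_comm).trans ?_
  rw [Finset.sum_comm]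
  refine Finset.sum_congr rfl fun h _ => ?_
  unfold fixedCard
  rw [Finset.card_filter]
  push_cast
  refine Finset.sum_congr rfl fun y _ => ?_
  rw [Finset.sum_eq_single (ρ g y)]
  · rw [map_mul, map_inv, Equiv.Perm.mul_apply]
    refine if_congr ⟨fun h' => ?_, fun h' => ⟨rfl, ?_⟩⟩ rfl rfl
    · rw [h'.2]; simp
    · rw [Equiv.Perm.inv_eq_iff_eq] at h'; exact h'
  · intro x _ hx
    rw [if_neg fun h' => hx h'.1]
  · simp

theorem matrixCoeff_sub (A B : Matrix (Fin n) (Fin n) ℂ) (v w : EuclideanSpace ℂ (Fin n)) :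
    matrixCoeff (A - B) v w = matrixCoeff A v w - matrixCoeff B v w := by
  unfold matrixCoeff
  rw [map_sub, _root_.sub_apply, inner_sub_right]

theorem matrixCoeff_add (A B : Matrix (Fin n) (Fin n) ℂ) (v w : EuclideanSpace ℂ (Fin n)) :
    matrixCoeff (A + B) v w = matrixCoeff A v w + matrixCoeff B v w := by
  unfold matrixCoeff
  rw [map_add, _root_.add_apply, inner_add_right]

theorem matrixCoeff_sum {ι : Type*} (s : Finset ι) (A : ι → Matrix (Fin n) (Fin n) ℂ)
    (v w : EuclideanSpace ℂ (Fin n)) :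
    matrixCoeff (∑ i ∈ s, A i) v w = ∑ i ∈ s, matrixCoeff (A i) v w := by
  unfold matrixCoeff
  rw [map_sum, _root_.sum_apply, inner_sum]

theorem norm_matrixCoeff_sub_average_sq_le (ρ : Γ →* Equiv.Perm (Fin n)) (T : Finset Γ)
    (K : Matrix (Fin n) (Fin n) ℂ) (v w : EuclideanSpace ℂ (Fin n)) :
    ‖matrixCoeff K v w - matrixCoeff (average ρ T K) v w‖ ^ 2 ≤
      2 * ‖matrixCoeff (collisionPart ρ T K) v w‖ ^ 2 +
        2 * T.card * ∑ g ∈ T, ‖matrixCoeff (twisted ρ (centeredCoeff ρ K g) g) v w‖ ^ 2 := by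
  have e : matrixCoeff K v w - matrixCoeff (average ρ T K) v w =
      matrixCoeff (collisionPart ρ T K) v w +
        ∑ g ∈ T, matrixCoeff (twisted ρ (centeredCoeff ρ K g) g) v w := by
    rw [← matrixCoeff_sub, ← matrixCoeff_sum, ← matrixCoeff_add, collisionPart, sub_add_cancel]
  rw [e]
  have h1 : ‖∑ g ∈ T, matrixCoeff (twisted ρ (centeredCoeff ρ K g) g) v w‖ ^ 2 ≤
      T.card * ∑ g ∈ T, ‖matrixCoeff (twisted ρ (centeredCoeff ρ K g) g) v w‖ ^ 2 :=
    (pow_le_pow_left₀ (norm_nonneg _) (norm_sum_le _ _) 2).trans sq_sum_le_card_mul_sum_sq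
  have h2 := add_pow_le (norm_nonneg (matrixCoeff (collisionPart ρ T K) v w))
    (norm_nonneg (∑ g ∈ T, matrixCoeff (twisted ρ (centeredCoeff ρ K g) g) v w)) 2
  have h3 := pow_le_pow_left₀ (norm_nonneg _)
    (norm_add_le (matrixCoeff (collisionPart ρ T K) v w)
      (∑ g ∈ T, matrixCoeff (twisted ρ (centeredCoeff ρ K g) g) v w)) 2
  norm_num at h2
  nlinarith

/-- The ℓ¹ bound holds for every N and includes eigenvectors not orthogonal to the constants, so the
polynomial inequalities apply at all eigenvalues. -/
theorem abs_eigenvalue_le (ρ : Γ →* Equiv.Perm (Fin n)) {p : MonoidAlgebra ℂ Γ}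
    {φ : OrthonormalBasis (Fin n) ℂ (EuclideanSpace ℂ (Fin n))} {ev : Fin n → ℝ}
    (hφ : IsEigenbasis (permOp ρ p) φ ev) (α : Fin n) : |ev α| ≤ ellOneNorm p := by
  have h1 : ∀ (σ : Equiv.Perm (Fin n)) (v : EuclideanSpace ℂ (Fin n)),
      ‖Matrix.toEuclideanCLM (𝕜 := ℂ) (permMat σ) v‖ = ‖v‖ := by
    intro σ v
    have : inner ℂ (Matrix.toEuclideanCLM (𝕜 := ℂ) (permMat σ) v)
        (Matrix.toEuclideanCLM (𝕜 := ℂ) (permMat σ) v) = inner ℂ v v := by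
      rw [← inner_conjTranspose, conjTranspose_permMat, ← toEuclideanCLM_mul_apply, ← permMat_mul,
        inv_mul_cancel, permMat_one, map_one]
      rfl
    rw [@norm_eq_sqrt_re_inner ℂ, this, ← norm_eq_sqrt_re_inner]
  have h2 := congrArg norm (hφ α)
  rw [norm_smul, φ.norm_eq_one, mul_one, Complex.norm_real, Real.norm_eq_abs] at h2
  rw [← h2]
  unfold permOp Finsupp.sum ellOneNorm
  rw [map_sum, _root_.sum_apply]
  refine (norm_sum_le _ _).trans (Finset.sum_le_sum fun g _ => ?_)
  rw [map_smul, _root_.smul_apply, norm_smul, h1, φ.norm_eq_one, mul_one]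

end Decomposition

/-! ### Lower bound for the number of eigenvalues in a window -/

section Density
variable {Γ : Type*} [Group Γ] {n : ℕ → ℕ} {ρ : ∀ k, Γ →* Equiv.Perm (Fin (n k))}

theorem tendsto_fixedCard_div (hρ : ConvergesInDistribution n ρ) {g : Γ} (hg : g ≠ 1) :
    Tendsto (fun k => (fixedCard (ρ k) g : ℝ) / n k) atTop (𝓝 0) := by
  have h := (hρ g hg).norm
  rw [norm_zero] at h
  refine h.congr fun k => ?_
  rw [trace_permMat, norm_div, Complex.norm_natCast, Complex.norm_natCast]

theorem tendsto_fixedCard_one_div (hn : Tendsto n atTop atTop) :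
    Tendsto (fun k => (fixedCard (ρ k) 1 : ℝ) / n k) atTop (𝓝 1) := by
  refine tendsto_const_nhds.congr' ?_
  filter_upwards [hn.eventually_ge_atTop 1] with k hk
  have : (n k : ℝ) ≠ 0 := by positivity
  unfold fixedCard
  simp [this]

theorem tendsto_trace_permOp_div (hn : Tendsto n atTop atTop) (hρ : ConvergesInDistribution n ρ)
    (f : MonoidAlgebra ℂ Γ) :
    Tendsto (fun k => (permOp (ρ k) f).trace / n k) atTop (𝓝 (f.coeff 1)) := by
  classical
  have h : ∀ u ∈ f.coeff.support, Tendsto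
      (fun k => f.coeff u * ((fixedCard (ρ k) u : ℝ) / n k : ℝ)) atTop
      (𝓝 (if 1 = u then f.coeff u else 0)) := by
    intro u _
    split_ifs with hu
    · subst hu
      have := (Complex.continuous_ofReal.tendsto _).comp
        (tendsto_fixedCard_one_div (ρ := ρ) hn)
      simpa using this.const_mul (f.coeff 1)
    · have := (Complex.continuous_ofReal.tendsto _).comp (tendsto_fixedCard_div hρ (Ne.symm hu))
      simpa using this.const_mul (f.coeff u)
  have h2 := tendsto_finsetSum _ h
  rw [Finset.sum_ite_eq] at h2
  have e : (if 1 ∈ f.coeff.support then f.coeff 1 else 0) = f.coeff 1 := by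
    split_ifs with h
    · rfl
    · exact (Finsupp.notMem_support_iff.1 h).symm
  rw [e] at h2
  refine h2.congr fun k => ?_
  rw [trace_permOp, Finset.sum_div]
  refine Finset.sum_congr rfl fun u _ => ?_
  push_cast
  ring

theorem sum_eval_eigenvalue {m : ℕ} {ρ : Γ →* Equiv.Perm (Fin m)} {p : MonoidAlgebra ℂ Γ}
    {φ : OrthonormalBasis (Fin m) ℂ (EuclideanSpace ℂ (Fin m))} {ev : Fin m → ℝ}
    (hφ : IsEigenbasis (permOp ρ p) φ ev) (q : Polynomial ℝ) :
    ((∑ α, q.eval (ev α) : ℝ) : ℂ) = (permOp ρ (Polynomial.aeval p q)).trace := by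
  rw [trace_eq_sum_matrixCoeff φ, permOp_aeval, Complex.ofReal_sum]
  refine Finset.sum_congr rfl fun α _ => ?_
  unfold matrixCoeff
  rw [toEuclideanCLM_aeval_apply _ (hφ α), inner_smul_right, inner_self_eq_norm_sq_to_K,
    φ.norm_eq_one]
  simp

theorem tendsto_sum_eval_div {φ : ∀ k, OrthonormalBasis (Fin (n k)) ℂ (EuclideanSpace ℂ (Fin (n k)))}
    {ev : ∀ k, Fin (n k) → ℝ} {p : MonoidAlgebra ℂ Γ}
    (hφ : ∀ k, IsEigenbasis (permOp (ρ k) p) (φ k) (ev k))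
    (hn : Tendsto n atTop atTop) (hρ : ConvergesInDistribution n ρ) (q : Polynomial ℝ) :
    Tendsto (fun k => (∑ α, q.eval (ev k α)) / n k) atTop
      (𝓝 ((Polynomial.aeval p q).coeff 1).re) := by
  have h := (Complex.continuous_re.tendsto _).comp
    (tendsto_trace_permOp_div hn hρ (Polynomial.aeval p q))
  refine h.congr fun k => ?_
  rw [Function.comp_apply, ← sum_eval_eigenvalue (hφ k), ← Complex.ofReal_natCast,
    ← Complex.ofReal_div, Complex.ofReal_re]

/-- Narrowing the kernel by κ shrinks its tail outside the window by 2κ. As the spectral mass of the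
narrow kernel stays bounded below, most of it must come from inside. -/
theorem poisson_scale_le {κ η : ℝ} (hκ : 0 < κ) (hη : 0 < η) {E x : ℝ} (hx : η < |x - E|) :
    poisson E (κ * η) x ≤ 2 * κ * poisson E η x := by
  have hsq : η ^ 2 < (x - E) ^ 2 := by
    rw [← sq_abs (x - E)]; gcongr
  unfold poisson
  have h0 : 0 < (x - E) ^ 2 + η ^ 2 := by positivity
  have h1 : 0 < (x - E) ^ 2 + (κ * η) ^ 2 := by positivity
  rw [← mul_div_assoc, div_le_div_iff₀ h1 h0]
  have h2 : (x - E) ^ 2 + η ^ 2 ≤ 2 * ((x - E) ^ 2 + (κ * η) ^ 2) := by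
    nlinarith [sq_nonneg (κ * η)]
  calc κ * η * ((x - E) ^ 2 + η ^ 2) ≤ κ * η * (2 * ((x - E) ^ 2 + (κ * η) ^ 2)) := by gcongr
    _ = _ := by ring

theorem mem_spectralIndices {m : ℕ} (ev : Fin m → ℝ) (J : Set ℝ) (α : Fin m) :
    α ∈ spectralIndices ev J ↔ ev α ∈ J := by
  simp [spectralIndices]

/-- Small spectral windows inside `I₀` contain a proportional number of eigenvalues. -/
theorem exists_card_spectralIndices_ge {S : Finset Γ} (hS : Generates S)
    (hn : Tendsto n atTop atTop) (hρ : ConvergesInDistribution n ρ)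
    {p : MonoidAlgebra ℂ Γ} (hp : IsSymmetric p) {I₀ : Set ℝ} (hAC : TwoSidedResolventBound p I₀)
    {φ : ∀ k, OrthonormalBasis (Fin (n k)) ℂ (EuclideanSpace ℂ (Fin (n k)))}
    {ev : ∀ k, Fin (n k) → ℝ} (hφ : ∀ k, IsEigenbasis (permOp (ρ k) p) (φ k) (ev k)) :
    ∃ c : ℝ, 0 < c ∧ ∀ E ∈ I₀, ∀ η : ℝ, 0 < η → η ≤ 1 → ∀ᶠ k in atTop,
      c * η * n k ≤ ((spectralIndices (ev k) (Set.Icc (E - η) (E + η))).card : ℝ) := by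
  obtain ⟨C₀, hC₀, hAC⟩ := hAC
  have hC : 0 < C₀ := by linarith
  -- The tail then carries at most about 2κC₀ = 1/(4C₀), a quarter of the guaranteed mass 1/C₀; with
  -- δ = 1/(16C₀) for the approximation errors, at least 1/(4C₀) is left inside the window.
  set κ : ℝ := 1 / (8 * C₀ ^ 2) with hκdef
  have hκ : 0 < κ := by positivity
  have hκ1 : κ ≤ 1 := by
    rw [hκdef, div_le_one (by positivity)]; nlinarith
  refine ⟨κ * (1 / (4 * C₀)), by positivity, fun E hE η hη hη1 => ?_⟩
  set δ : ℝ := 1 / (16 * C₀) with hδdef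
  have hδ : 0 < δ := by positivity
  have ht : 0 < κ * η := by positivity
  obtain ⟨q, hq1, hq2, -⟩ := exists_poisson_approx hS hp le_rfl E hη hδ
  obtain ⟨q', hq1', hq2', -⟩ := exists_poisson_approx hS hp le_rfl E ht hδ
  have b1 := (hAC E hE η hη hη1).2
  have b2 := (hAC E hE (κ * η) ht (by nlinarith)).1
  rw [imResolvent_one_one] at b1 b2
  have a1 : ((Polynomial.aeval p q).coeff 1).re < C₀ + 2 * δ := by
    have := (Complex.abs_re_le_norm _).trans hq2
    rw [Complex.sub_re] at this
    linarith [(abs_le.1 this).2]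
  have a2 : C₀⁻¹ - 2 * δ < ((Polynomial.aeval p q').coeff 1).re := by
    have := (Complex.abs_re_le_norm _).trans hq2'
    rw [Complex.sub_re] at this
    linarith [(abs_le.1 this).1]
  filter_upwards [(tendsto_sum_eval_div hφ hn hρ q).eventually_lt_const a1,
    (tendsto_sum_eval_div hφ hn hρ q').eventually_const_lt a2,
    hn.eventually_ge_atTop 1] with k h1 h2 hk
  have hN : (0 : ℝ) < n k := by exact_mod_cast hk
  rw [div_lt_iff₀ hN] at h1
  rw [lt_div_iff₀ hN] at h2
  set J := Set.Icc (E - η) (E + η)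
  have key : ∀ α, q'.eval (ev k α) ≤ (if ev k α ∈ J then 1 / (κ * η) else 0) +
      2 * κ * (q.eval (ev k α) + δ) := by
    intro α
    have hα := abs_eigenvalue_le (ρ k) (hφ k) α
    have h3 := hq1 _ hα
    have h4 := hq1' _ hα
    split_ifs with hJ
    · have h5 := poisson_le ht E (ev k α)
      have : 0 ≤ 2 * κ * (q.eval (ev k α) + δ) := by
        have := h3.1
        positivity
      linarith
    · have hx : η < |ev k α - E| := by
        by_contra hcon
        have := abs_le.1 (not_lt.1 hcon)
        exact hJ ⟨by linarith, by linarith⟩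
      have h5 := poisson_scale_le hκ hη hx
      have h6 : 2 * κ * poisson E η (ev k α) ≤ 2 * κ * (q.eval (ev k α) + δ) := by
        have := h3.2.2
        gcongr
      linarith [h4.2.1]
  have hsum := Finset.sum_le_sum fun α (_ : α ∈ Finset.univ) => key α
  rw [Finset.sum_add_distrib, ← Finset.mul_sum, Finset.sum_add_distrib, Finset.sum_const,
    ← Finset.sum_filter, Finset.sum_const, Finset.card_univ, Fintype.card_fin, nsmul_eq_mul,
    nsmul_eq_mul] at hsum
  have hcard : (Finset.univ.filter fun α => ev k α ∈ J).card = (spectralIndices (ev k) J).card := by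
    congr 1
    ext α
    rw [mem_spectralIndices]
    simp
  rw [hcard] at hsum
  set X : ℝ := ((spectralIndices (ev k) J).card : ℝ)
  have h3 : 2 * κ * (∑ α, q.eval (ev k α) + n k * δ) ≤ 2 * κ * ((C₀ + 3 * δ) * n k) := by
    gcongr
    linarith
  have h4 : (C₀⁻¹ - 2 * δ - 2 * κ * (C₀ + 3 * δ)) * n k ≤ X * (1 / (κ * η)) := by linarith
  have h5 : 1 / (4 * C₀) ≤ C₀⁻¹ - 2 * δ - 2 * κ * (C₀ + 3 * δ) := by
    have : C₀⁻¹ - 2 * δ - 2 * κ * (C₀ + 3 * δ) - 1 / (4 * C₀) =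
        (24 * C₀ ^ 2 - 3) / (64 * C₀ ^ 3) := by
      rw [hδdef, hκdef]
      field_simp
      ring
    have h6 : 0 ≤ (24 * C₀ ^ 2 - 3) / (64 * C₀ ^ 3) := by
      apply div_nonneg _ (by positivity)
      nlinarith
    linarith
  have h6 : 1 / (4 * C₀) * n k ≤ X * (1 / (κ * η)) := (by gcongr : _ ≤ _).trans h4
  rw [mul_one_div, le_div_iff₀ ht] at h6
  linarith

end Density

/-! ### The two-window estimate -/

section Mixing
variable {Γ : Type*} [Group Γ]

/-- On the windows 1 ≤ (4ηq₂)(4ηq₁), whence 16η². Nonnegativity of q₁ and q₂ on the spectrum allows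
extension to all pairs α, β, where the sum is a trace. -/
theorem sum_twisted_le {m : ℕ} {ρ : Γ →* Equiv.Perm (Fin m)} {p : MonoidAlgebra ℂ Γ}
    {φ : OrthonormalBasis (Fin m) ℂ (EuclideanSpace ℂ (Fin m))} {ev : Fin m → ℝ}
    (hφ : IsEigenbasis (permOp ρ p) φ ev) {E₁ E₂ η : ℝ} (hη : 0 < η) {q₁ q₂ : Polynomial ℝ}
    (h₁ : ∀ x, |x| ≤ ellOneNorm p → 0 ≤ q₁.eval x)
    (h₁' : ∀ x, |x| ≤ ellOneNorm p → |x - E₁| ≤ η → 1 ≤ 4 * η * q₁.eval x)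
    (h₂ : ∀ x, |x| ≤ ellOneNorm p → 0 ≤ q₂.eval x)
    (h₂' : ∀ x, |x| ≤ ellOneNorm p → |x - E₂| ≤ η → 1 ≤ 4 * η * q₂.eval x)
    {a : Fin m → ℂ} (ha : ∀ x, ‖a x‖ ≤ 2) (ha0 : ∑ x, a x = 0) (g : Γ) :
    ∑ α ∈ spectralIndices ev (Set.Icc (E₁ - η) (E₁ + η)),
        ∑ β ∈ spectralIndices ev (Set.Icc (E₂ - η) (E₂ + η)),
          ‖matrixCoeff (twisted ρ a g) (φ β) (φ α)‖ ^ 2 ≤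
      16 * η ^ 2 * (4 * m * normOnOnesPerp (permOp ρ (hadamard (Polynomial.aeval p q₂)
        (conjBy g (Polynomial.aeval p q₁)))) +
          nonfreeError ρ (Polynomial.aeval p q₂) (conjBy g (Polynomial.aeval p q₁))) := by
  set X := twisted ρ a g
  have hev := abs_eigenvalue_le ρ hφ
  have hb : ∀ {E x : ℝ}, x ∈ Set.Icc (E - η) (E + η) → |x - E| ≤ η := fun hx =>
    abs_le.2 ⟨by linarith [hx.1], by linarith [hx.2]⟩
  have key : ∀ α ∈ spectralIndices ev (Set.Icc (E₁ - η) (E₁ + η)),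
      ∀ β ∈ spectralIndices ev (Set.Icc (E₂ - η) (E₂ + η)),
      ‖matrixCoeff X (φ β) (φ α)‖ ^ 2 ≤ 16 * η ^ 2 *
        (q₂.eval (ev β) * q₁.eval (ev α) * ‖matrixCoeff X (φ β) (φ α)‖ ^ 2) := by
    intro α hα β hβ
    have a1 := h₁' _ (hev α) (hb ((mem_spectralIndices _ _ _).1 hα))
    have a2 := h₂' _ (hev β) (hb ((mem_spectralIndices _ _ _).1 hβ))
    have a3 : 1 ≤ (4 * η * q₂.eval (ev β)) * (4 * η * q₁.eval (ev α)) :=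
      one_le_mul_of_one_le_of_one_le a2 a1
    calc _ ≤ ((4 * η * q₂.eval (ev β)) * (4 * η * q₁.eval (ev α))) *
          ‖matrixCoeff X (φ β) (φ α)‖ ^ 2 := le_mul_of_one_le_left (by positivity) a3
      _ = _ := by ring
  have hnn : ∀ α β, 0 ≤ q₂.eval (ev β) * q₁.eval (ev α) * ‖matrixCoeff X (φ β) (φ α)‖ ^ 2 :=
    fun α β => mul_nonneg (mul_nonneg (h₂ _ (hev β)) (h₁ _ (hev α))) (by positivity)
  have htr := sum_eigen_eq_trace φ (A := permOp ρ (Polynomial.aeval p q₂))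
    (B := permOp ρ (Polynomial.aeval p q₁)) (a := fun β => q₂.eval (ev β))
    (b := fun α => q₁.eval (ev α))
    (fun β => by rw [permOp_aeval]; exact toEuclideanCLM_aeval_apply _ (hφ β) q₂)
    (fun α => by rw [permOp_aeval]; exact toEuclideanCLM_aeval_apply _ (hφ α) q₁) X
  have h3 := norm_trace_twisted_sub_le ρ ha g (Polynomial.aeval p q₂) (Polynomial.aeval p q₁)
  have h4 := norm_inner_toEuclideanCLM_le ha ha0
    (permOp ρ (hadamard (Polynomial.aeval p q₂) (conjBy g (Polynomial.aeval p q₁))))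
  rw [← htr] at h3
  have h5 := norm_le_norm_add_norm_sub'
    (((∑ α, ∑ β, q₂.eval (ev β) * q₁.eval (ev α) * ‖matrixCoeff X (φ β) (φ α)‖ ^ 2 : ℝ) : ℂ))
    (inner ℂ (WithLp.toLp 2 a) (Matrix.toEuclideanCLM (𝕜 := ℂ) (permOp ρ
      (hadamard (Polynomial.aeval p q₂) (conjBy g (Polynomial.aeval p q₁)))) (WithLp.toLp 2 a)))
  rw [Complex.norm_real, Real.norm_of_nonneg (Finset.sum_nonneg fun α _ =>
    Finset.sum_nonneg fun β _ => hnn α β)] at h5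
  calc _ ≤ ∑ α ∈ spectralIndices ev (Set.Icc (E₁ - η) (E₁ + η)),
        ∑ β ∈ spectralIndices ev (Set.Icc (E₂ - η) (E₂ + η)), 16 * η ^ 2 *
        (q₂.eval (ev β) * q₁.eval (ev α) * ‖matrixCoeff X (φ β) (φ α)‖ ^ 2) :=
        Finset.sum_le_sum fun α hα => Finset.sum_le_sum fun β hβ => key α hα β hβ
    _ = 16 * η ^ 2 * ∑ α ∈ spectralIndices ev (Set.Icc (E₁ - η) (E₁ + η)),
        ∑ β ∈ spectralIndices ev (Set.Icc (E₂ - η) (E₂ + η)),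
        (q₂.eval (ev β) * q₁.eval (ev α) * ‖matrixCoeff X (φ β) (φ α)‖ ^ 2) := by
        simp only [Finset.mul_sum]
    _ ≤ 16 * η ^ 2 * ∑ α, ∑ β,
        (q₂.eval (ev β) * q₁.eval (ev α) * ‖matrixCoeff X (φ β) (φ α)‖ ^ 2) := by
        gcongr
        refine (Finset.sum_le_sum fun α _ => Finset.sum_le_univ_sum_of_nonneg fun β => hnn α β).trans
          (Finset.sum_le_univ_sum_of_nonneg fun α => Finset.sum_nonneg fun β _ => hnn α β)
    _ ≤ _ := by
        gcongr
        linarith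

variable {n : ℕ → ℕ} {ρ : ∀ k, Γ →* Equiv.Perm (Fin (n k))}

theorem tendsto_nonfreeError_div (hρ : ConvergesInDistribution n ρ) (x y : MonoidAlgebra ℂ Γ) :
    Tendsto (fun k => nonfreeError (ρ k) x y / n k) atTop (𝓝 0) := by
  classical
  have h : Tendsto (fun k => ∑ u ∈ x.coeff.support, ∑ v ∈ y.coeff.support.erase u⁻¹,
      ‖x.coeff u‖ * ‖y.coeff v‖ * 4 * ((fixedCard (ρ k) (v * u) : ℝ) / n k)) atTop
      (𝓝 (∑ u ∈ x.coeff.support, ∑ v ∈ y.coeff.support.erase u⁻¹, 0)) := by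
    refine tendsto_finsetSum _ fun u _ => tendsto_finsetSum _ fun v hv => ?_
    have hne : v * u ≠ 1 := fun h => Finset.ne_of_mem_erase hv (mul_eq_one_iff_eq_inv.1 h)
    simpa using (tendsto_fixedCard_div hρ hne).const_mul (‖x.coeff u‖ * ‖y.coeff v‖ * 4)
  simp only [Finset.sum_const_zero] at h
  refine h.congr fun k => ?_
  unfold nonfreeError
  rw [Finset.sum_div]
  refine Finset.sum_congr rfl fun u _ => ?_
  rw [Finset.sum_div]
  refine Finset.sum_congr (by congr) fun v _ => ?_
  ring

theorem eventually_sum_norm_collisionPart_le (hn : Tendsto n atTop atTop)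
    (hρ : ConvergesInDistribution n ρ) {T : Finset Γ}
    {K : ∀ k, Matrix (Fin (n k)) (Fin (n k)) ℂ} (hloc : ∀ k, IsLocal (ρ k) T (K k))
    (hK : ∀ k x y, ‖K k x y‖ ≤ 1) {ε : ℝ} (hε : 0 < ε) :
    ∀ᶠ k in atTop, ∑ x, ∑ y, ‖collisionPart (ρ k) T (K k) x y‖ ^ 2 ≤ ε * n k := by
  classical
  have h : Tendsto (fun k => (T.card : ℝ) ^ 2 * ∑ g ∈ T, ∑ h ∈ T.erase g,
      ((fixedCard (ρ k) (h⁻¹ * g) : ℝ) / n k)) atTop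
      (𝓝 ((T.card : ℝ) ^ 2 * ∑ g ∈ T, ∑ h ∈ T.erase g, 0)) := by
    refine (tendsto_finsetSum _ fun g _ => tendsto_finsetSum _ fun h hh => ?_).const_mul _
    exact tendsto_fixedCard_div hρ fun h' => Finset.ne_of_mem_erase hh (inv_mul_eq_one.1 h')
  simp only [Finset.sum_const_zero, mul_zero] at h
  filter_upwards [h.eventually_le_const hε, hn.eventually_ge_atTop 1] with k h1 hk
  have hN : (0 : ℝ) < n k := by exact_mod_cast hk
  have h2 := sum_norm_collisionPart_le (ρ k) (hloc k) (hK k)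
  refine h2.trans ?_
  rw [← div_le_iff₀ hN, mul_div_assoc, Finset.sum_div]
  refine le_trans (le_of_eq ?_) h1
  congr 1
  refine Finset.sum_congr rfl fun g _ => ?_
  rw [Finset.sum_div]

/-- The order of limits is essential: η and the polynomials are fixed first, so that only finitely
many group elements occur when N → ∞. The threshold for η is uniform in E₁ and E₂; that for N need
not be. -/
theorem eventually_sum_sq_le {S : Finset Γ} (hS : Generates S) (hn : Tendsto n atTop atTop)
    (hρ : ConvergesStrongly n ρ) {C₁ : ℝ} (hRD : RapidDecay Γ C₁) {p : MonoidAlgebra ℂ Γ}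
    (hp : IsSymmetric p) {I₀ : Set ℝ} (hAC : TwoSidedResolventBound p I₀) {r : ℝ}
    (hr : 2 * C₁ + 1 < r) (hdecay : ResolventFourthMomentDecay S p I₀ r)
    {φ : ∀ k, OrthonormalBasis (Fin (n k)) ℂ (EuclideanSpace ℂ (Fin (n k)))}
    {ev : ∀ k, Fin (n k) → ℝ} (hφ : ∀ k, IsEigenbasis (permOp (ρ k) p) (φ k) (ev k))
    {T : Finset Γ} {K : ∀ k, Matrix (Fin (n k)) (Fin (n k)) ℂ}
    (hloc : ∀ k, IsLocal (ρ k) T (K k)) (hK : ∀ k x y, ‖K k x y‖ ≤ 1) {ε : ℝ} (hε : 0 < ε) :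
    ∀ᶠ η : ℝ in 𝓝[>] 0, ∀ E₁ ∈ I₀, ∀ E₂ ∈ I₀, ∀ᶠ k in atTop,
      ∑ α ∈ spectralIndices (ev k) (Set.Icc (E₁ - η) (E₁ + η)),
        ∑ β ∈ spectralIndices (ev k) (Set.Icc (E₂ - η) (E₂ + η)),
          ‖matrixCoeff (K k) (φ k β) (φ k α) -
            matrixCoeff (average (ρ k) T (K k)) (φ k β) (φ k α)‖ ^ 2 ≤ ε * η * n k := by
  have hr0 : 0 < r := by linarith [hRD.1]
  obtain ⟨C, hC, hRD⟩ := exists_norm_regularOp_le hS hRD hr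
  -- The collision part costs 2ε₂, and the twisted parts cost 2|T| · |T| · 144 ε₂, with 144 = 16(4 ·
  -- 2 + 1) from the quadratic form and the non-free error.
  set ε₂ : ℝ := ε / (2 + 288 * (T.card : ℝ) ^ 2) with hε₂def
  have hε₂ : 0 < ε₂ := by positivity
  set G : ℝ := 1 + ∑ g ∈ T, (1 + 2 * wordLength S g : ℝ) ^ r with hG
  have hGpos : 0 < G := by
    have : 0 ≤ ∑ g ∈ T, (1 + 2 * wordLength S g : ℝ) ^ r :=
      Finset.sum_nonneg fun _ _ => by positivity
    linarith
  have hGg : ∀ g ∈ T, (1 + 2 * wordLength S g : ℝ) ^ r ≤ G := fun g hg => by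
    have := Finset.single_le_sum (f := fun g => (1 + 2 * wordLength S g : ℝ) ^ r)
      (fun _ _ => by positivity) hg
    linarith
  filter_upwards [eventually_exists_approx hS hp hAC hr0 hdecay
    (ε := (ε₂ / C) ^ 2 / (2 * G)) (by positivity), self_mem_nhdsWithin] with η happ hη E₁ hE₁ E₂ hE₂
  have hη : 0 < η := hη
  obtain ⟨q₁, h₁, h₁', w₁⟩ := happ E₁ hE₁
  obtain ⟨q₂, h₂, h₂', w₂⟩ := happ E₂ hE₂
  set f₁ := Polynomial.aeval p q₁
  set f₂ := Polynomial.aeval p q₂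
  have hlam : ∀ g ∈ T, ‖regularOp (hadamard f₂ (conjBy g f₁))‖ ≤ ε₂ / η := by
    intro g hg
    refine (hRD _).trans ?_
    rw [mul_comm, ← le_div_iff₀ hC]
    refine Real.sqrt_le_iff.2 ⟨by positivity, ?_⟩
    refine (sum_hadamard_le hS hr0.le g f₂ f₁).trans ?_
    have h3 : weightedFourth S r f₂ + weightedFourth S r f₁ ≤ (ε₂ / C) ^ 2 / G / η ^ 2 := by
      rw [le_div_iff₀ (by positivity)]
      have : (ε₂ / C) ^ 2 / G = (ε₂ / C) ^ 2 / (2 * G) + (ε₂ / C) ^ 2 / (2 * G) := by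
        field_simp; norm_num
      rw [this]
      linarith
    have h0 : 0 ≤ weightedFourth S r f₂ + weightedFourth S r f₁ :=
      add_nonneg (Finset.sum_nonneg fun u _ => mul_nonneg (by positivity) (weight_pos r u).le)
        (Finset.sum_nonneg fun u _ => mul_nonneg (by positivity) (weight_pos r u).le)
    calc _ ≤ G * ((ε₂ / C) ^ 2 / G / η ^ 2) := mul_le_mul (hGg g hg) h3 h0 hGpos.le
      _ = (ε₂ / η / C) ^ 2 := by field_simp
  have e1 : ∀ᶠ k in atTop, ∀ g ∈ T,
      normOnOnesPerp (permOp (ρ k) (hadamard f₂ (conjBy g f₁))) < 2 * (ε₂ / η) := by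
    rw [Filter.eventually_all_finset]
    intro g hg
    refine (hρ.2 _).eventually_lt_const ?_
    have := hlam g hg
    have : 0 < ε₂ / η := by positivity
    linarith
  have e2 : ∀ᶠ k in atTop, ∀ g ∈ T,
      nonfreeError (ρ k) f₂ (conjBy g f₁) / n k < ε₂ / η := by
    rw [Filter.eventually_all_finset]
    intro g _
    exact (tendsto_nonfreeError_div hρ.1 _ _).eventually_lt_const (by positivity)
  filter_upwards [e1, e2, eventually_sum_norm_collisionPart_le hn hρ.1 hloc hK
    (ε := ε₂ * η) (by positivity), hn.eventually_ge_atTop 1] with k k1 k2 k3 hk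
  have hN : (0 : ℝ) < n k := by exact_mod_cast hk
  set Λ₁ := spectralIndices (ev k) (Set.Icc (E₁ - η) (E₁ + η))
  set Λ₂ := spectralIndices (ev k) (Set.Icc (E₂ - η) (E₂ + η))
  have hcoll : ∑ α ∈ Λ₁, ∑ β ∈ Λ₂,
      ‖matrixCoeff (collisionPart (ρ k) T (K k)) (φ k β) (φ k α)‖ ^ 2 ≤ ε₂ * η * n k := by
    refine le_trans ?_ k3
    rw [← sum_matrixCoeff_sq (φ k)]
    exact (Finset.sum_le_sum fun α _ => Finset.sum_le_univ_sum_of_nonneg fun β => by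
      positivity).trans (Finset.sum_le_univ_sum_of_nonneg fun α => Finset.sum_nonneg fun β _ => by
      positivity)
  have htw : ∀ g ∈ T, ∑ α ∈ Λ₁, ∑ β ∈ Λ₂,
      ‖matrixCoeff (twisted (ρ k) (centeredCoeff (ρ k) (K k) g) g) (φ k β) (φ k α)‖ ^ 2 ≤
        144 * (ε₂ * η * n k) := by
    intro g hg
    have h3 := sum_twisted_le (hφ k) hη h₁ h₁' h₂ h₂'
      (norm_centeredCoeff_le (ρ k) (hK k) g) (sum_centeredCoeff (ρ k) (K k) g) g
    have h4 := (div_lt_iff₀ hN).1 (k2 g hg)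
    have h5 := k1 g hg
    refine h3.trans ?_
    calc _ ≤ 16 * η ^ 2 * (4 * n k * (2 * (ε₂ / η)) + ε₂ / η * n k) := by gcongr
      _ = _ := by field_simp; ring
  calc _ ≤ ∑ α ∈ Λ₁, ∑ β ∈ Λ₂,
        (2 * ‖matrixCoeff (collisionPart (ρ k) T (K k)) (φ k β) (φ k α)‖ ^ 2 +
        2 * T.card * ∑ g ∈ T, ‖matrixCoeff (twisted (ρ k) (centeredCoeff (ρ k) (K k) g) g)
          (φ k β) (φ k α)‖ ^ 2) :=
        Finset.sum_le_sum fun α _ => Finset.sum_le_sum fun β _ =>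
          norm_matrixCoeff_sub_average_sq_le (ρ k) T (K k) _ _
    _ = 2 * ∑ α ∈ Λ₁, ∑ β ∈ Λ₂,
        ‖matrixCoeff (collisionPart (ρ k) T (K k)) (φ k β) (φ k α)‖ ^ 2 +
        2 * T.card * ∑ g ∈ T, ∑ α ∈ Λ₁, ∑ β ∈ Λ₂,
          ‖matrixCoeff (twisted (ρ k) (centeredCoeff (ρ k) (K k) g) g) (φ k β) (φ k α)‖ ^ 2 := by
        simp only [Finset.sum_add_distrib, ← Finset.mul_sum]
        congr 2
        rw [Finset.sum_comm]
        refine (Finset.sum_congr rfl fun β _ => Finset.sum_comm).trans ?_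
        rw [Finset.sum_comm]
        exact Finset.sum_congr rfl fun g _ => Finset.sum_comm
    _ ≤ 2 * (ε₂ * η * n k) + 2 * T.card * ∑ g ∈ T, 144 * (ε₂ * η * n k) := by
        gcongr with g hg
        exact htw g hg
    _ = (2 + 288 * (T.card : ℝ) ^ 2) * ε₂ * (η * n k) := by
        rw [Finset.sum_const, nsmul_eq_mul]; ring
    _ = ε * η * n k := by
        rw [hε₂def, mul_div_cancel₀ _ (by positivity)]; ring

end Mixing

/-! ### Covering an interval by small windows -/

section Main

theorem sum_diag_le_sum_cover {m : ℕ} {ev : Fin m → ℝ} (D : Fin m → Fin m → ℝ)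
    (hD : ∀ α β, 0 ≤ D α β) {I : Set ℝ} {ι : Type*} (s : Finset ι) (J : ι → Set ℝ)
    (hcov : ∀ x ∈ I, ∃ i ∈ s, x ∈ J i) :
    ∑ α ∈ spectralIndices ev I, D α α ≤
      ∑ i ∈ s, ∑ α ∈ spectralIndices ev (J i), ∑ β ∈ spectralIndices ev (J i), D α β := by
  classical
  have h1 : ∀ i, ∑ α ∈ spectralIndices ev (J i), D α α ≤
      ∑ α ∈ spectralIndices ev (J i), ∑ β ∈ spectralIndices ev (J i), D α β := fun i =>
    Finset.sum_le_sum fun α hα =>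
      Finset.single_le_sum (f := fun β => D α β) (fun β _ => hD α β) hα
  refine le_trans ?_ (Finset.sum_le_sum fun i _ => h1 i)
  have h2 : ∀ i ∈ s, ∑ α ∈ spectralIndices ev (J i), D α α =
      ∑ α, if ev α ∈ J i then D α α else 0 := by
    intro i _
    rw [← Finset.sum_filter]
    exact Finset.sum_congr (by ext α; simp [mem_spectralIndices]) fun _ _ => rfl
  rw [Finset.sum_congr rfl h2, Finset.sum_comm]
  have hnn : ∀ α, 0 ≤ ∑ i ∈ s, if ev α ∈ J i then D α α else 0 := fun α =>
    Finset.sum_nonneg fun i _ => by split_ifs; exacts [hD α α, le_rfl]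
  refine le_trans (Finset.sum_le_sum fun α hα => ?_)
    (Finset.sum_le_univ_sum_of_nonneg (s := spectralIndices ev I) hnn)
  obtain ⟨i, hi, hx⟩ := hcov _ ((mem_spectralIndices _ _ _).1 hα)
  have := Finset.single_le_sum (f := fun i => if ev α ∈ J i then D α α else 0)
    (fun i _ => by split_ifs; exacts [hD α α, le_rfl]) hi
  simpa [hx] using this

theorem exists_mem_grid {a b η x : ℝ} (hη : 0 < η) (hx : x ∈ Set.Icc a b) :
    ∃ i ∈ Finset.range (⌊(b - a) / η⌋₊ + 1), x ∈ Set.Icc (a + i * η - η) (a + i * η + η) := by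
  have h0 : 0 ≤ (x - a) / η := div_nonneg (by linarith [hx.1]) hη.le
  refine ⟨⌊(x - a) / η⌋₊, Finset.mem_range.2 (Nat.lt_succ_of_le (Nat.floor_le_floor ?_)), ?_, ?_⟩
  · have := hx.2
    gcongr
  · have := Nat.floor_le h0
    rw [le_div_iff₀ hη] at this
    linarith
  · have := Nat.lt_floor_add_one ((x - a) / η)
    rw [div_lt_iff₀ hη] at this
    linarith

theorem grid_mem {a b η : ℝ} (hη : 0 < η) (hab : a ≤ b) {i : ℕ}
    (hi : i ∈ Finset.range (⌊(b - a) / η⌋₊ + 1)) : a + i * η ∈ Set.Icc a b := by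
  have h1 : (i : ℝ) ≤ (b - a) / η :=
    (Nat.cast_le.2 (Nat.lt_succ_iff.1 (Finset.mem_range.1 hi))).trans
      (Nat.floor_le (div_nonneg (by linarith) hη.le))
  rw [le_div_iff₀ hη] at h1
  exact ⟨by nlinarith [show (0 : ℝ) ≤ i * η by positivity], by linarith⟩

theorem inv_card_mul_le {X s N ε c : ℝ} (hc : 0 < c) (hN : 0 < N) (hX : c * N ≤ X)
    (hs : s ≤ ε * (c * N)) (hε : 0 ≤ ε) : 1 / X * s ≤ ε := by
  have hX0 : 0 < X := (mul_pos hc hN).trans_le hX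
  rw [one_div_mul_eq_div, div_le_iff₀ hX0]
  exact hs.trans (by gcongr)

end Main

end

end QuantumMixing

/-! ### Quantum ergodicity and small-scale mixing -/

open QuantumMixing in
theorem theoremt {Γ : Type*} [Group Γ]
    -- a finite generating set, fixing the word length on the group
    (S : Finset Γ) (hS : Generates S)
    -- permutation representations of growing dimension, converging strongly
    (n : ℕ → ℕ) (hn : Tendsto n atTop atTop)
    (ρ : ∀ k, Γ →* Equiv.Perm (Fin (n k))) (hρ : ConvergesStrongly n ρ)
    -- rapid decay
    (C₁ : ℝ) (hRD : RapidDecay Γ C₁)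
    -- the symbol and its resolvent bounds on the compact interval with end points `c` and `d`
    (p : MonoidAlgebra ℂ Γ) (hp : IsSymmetric p)
    (c d : ℝ) (hAC : TwoSidedResolventBound p (Set.Icc c d))
    (C₁' : ℝ) (hC₁' : 2 * C₁ + 1 < C₁')
    (hdecay : ResolventFourthMomentDecay S p (Set.Icc c d) C₁')
    -- a closed interval in the interior
    (a b : ℝ) (hca : c < a) (hab : a < b) (hbd : b < d)
    -- orthonormal eigenbases
    (φ : ∀ k, OrthonormalBasis (Fin (n k)) ℂ (EuclideanSpace ℂ (Fin (n k))))
    (ev : ∀ k, Fin (n k) → ℝ) (hφ : ∀ k, IsEigenbasis (permOp (ρ k) p) (φ k) (ev k))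
    -- local observables
    (T : Finset Γ) (K : ∀ k, Matrix (Fin (n k)) (Fin (n k)) ℂ)
    (hKloc : ∀ k, IsLocal (ρ k) T (K k)) (hKbd : ∀ k x y, ‖K k x y‖ ≤ 1) :
    QuantumErgodicity n ρ φ ev T K (Set.Icc a b) ∧
      SmallScaleQuantumMixing n ρ φ ev T K (Set.Icc a b) := by
  have hsub : ∀ {x : ℝ}, x ∈ Set.Icc a b → x ∈ Set.Icc c d := fun hx =>
    ⟨hca.le.trans hx.1, hx.2.trans hbd.le⟩
  obtain ⟨c₀, hc₀, hcard⟩ := exists_card_spectralIndices_ge hS hn hρ.1 hp hAC hφ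
  have hcore : ∀ ε : ℝ, 0 < ε → _ := fun ε hε =>
    eventually_sum_sq_le hS hn hρ hRD hp hAC hC₁' hdecay hφ hKloc hKbd hε
  have hIoc : ∀ᶠ η : ℝ in 𝓝[>] 0, η ∈ Set.Ioc (0 : ℝ) 1 := Ioc_mem_nhdsGT one_pos
  constructor
  · unfold QuantumErgodicity
    -- A window of half-width η₀ about the midpoint fits inside [a, b], so |Λ_I| ≥ c₀η₀N with η₀
    -- independent of the covering scale.
    set η₀ : ℝ := min ((b - a) / 2) 1
    have hη₀ : 0 < η₀ := lt_min (by linarith) one_pos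
    have hη₀' : η₀ ≤ (b - a) / 2 := min_le_left _ _
    rw [Metric.tendsto_nhds]
    intro ε hε
    -- The grid has ⌊(b − a)/η⌋ + 1 windows, each contributing ε₁ηN; as η ≤ 1, the total is at most
    -- (b − a + 1) ε₁N.
    set ε₁ : ℝ := ε / 2 * (c₀ * η₀) / (b - a + 1) with hε₁
    have hba : 0 < b - a + 1 := by linarith
    obtain ⟨η, hη, hη01⟩ := ((hcore ε₁ (by positivity)).and hIoc).exists
    have hall : ∀ᶠ k in atTop, ∀ i ∈ Finset.range (⌊(b - a) / η⌋₊ + 1), _ :=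
      (Filter.eventually_all_finset _).2 fun i hi =>
        hη _ (hsub (grid_mem hη01.1 hab.le hi)) _ (hsub (grid_mem hη01.1 hab.le hi))
    filter_upwards [hall, hcard ((a + b) / 2) (hsub ⟨by linarith, by linarith⟩) η₀ hη₀
      (min_le_right _ _), hn.eventually_ge_atTop 1] with k hk hcardk hnk
    have hN : (0 : ℝ) < n k := by exact_mod_cast hnk
    have hle : ergodicVariance (φ k) (ev k) (K k) (average (ρ k) T (K k)) (Set.Icc a b) ≤
        ε / 2 := by
      unfold ergodicVariance
      refine inv_card_mul_le (c := c₀ * η₀) (by positivity) hN (hcardk.trans ?_) ?_ (by positivity)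
      · rw [Nat.cast_le]
        refine Finset.card_le_card fun α hα => ?_
        rw [mem_spectralIndices] at hα ⊢
        exact ⟨by linarith [hα.1], by linarith [hα.2]⟩
      · refine (sum_diag_le_sum_cover (fun α β => ‖matrixCoeff (K k) (φ k β) (φ k α) -
          matrixCoeff (average (ρ k) T (K k)) (φ k β) (φ k α)‖ ^ 2) (fun _ _ => by positivity)
          _ (fun i : ℕ => Set.Icc (a + i * η - η) (a + i * η + η))
          fun x hx => exists_mem_grid hη01.1 hx).trans ?_
        refine (Finset.sum_le_sum hk).trans ?_
        rw [Finset.sum_const, Finset.card_range, nsmul_eq_mul]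
        have h1 : (⌊(b - a) / η⌋₊ : ℝ) * η ≤ b - a :=
          (le_div_iff₀ hη01.1).1 (Nat.floor_le (div_nonneg (by linarith) hη01.1.le))
        have h2 : ((⌊(b - a) / η⌋₊ + 1 : ℕ) : ℝ) * η ≤ b - a + 1 := by
          push_cast
          linarith [hη01.2]
        calc ((⌊(b - a) / η⌋₊ + 1 : ℕ) : ℝ) * (ε₁ * η * n k)
            = (((⌊(b - a) / η⌋₊ + 1 : ℕ) : ℝ) * η) * (ε₁ * n k) := by ring
          _ ≤ (b - a + 1) * (ε₁ * n k) := by gcongr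
          _ = ε / 2 * (c₀ * η₀ * n k) := by rw [hε₁]; field_simp
    have h0 : 0 ≤ ergodicVariance (φ k) (ev k) (K k) (average (ρ k) T (K k)) (Set.Icc a b) := by
      unfold ergodicVariance
      positivity
    rw [Real.dist_eq, sub_zero, abs_of_nonneg h0]
    linarith
  · intro E₁ hE₁ E₂ hE₂
    rw [ENNReal.tendsto_nhds_zero]
    intro ε hε
    obtain ⟨ε', hε', hε'ε⟩ := ENNReal.lt_iff_exists_nnreal_btwn.1 hε
    have hε'0 : (0 : ℝ) < ε' := by simpa using hε'
    -- The double sum is at most ε'c₀ηN and the first window holds at least c₀ηN eigenvalues, so the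
    -- quotient is at most ε'.
    filter_upwards [hcore (ε' * c₀) (by positivity), hIoc] with η hη hη01
    have h1 := hsub (interior_subset hE₁)
    refine Filter.limsup_le_of_le (by isBoundedDefault) ?_
    filter_upwards [hη E₁ h1 E₂ (hsub (interior_subset hE₂)), hcard E₁ h1 η hη01.1 hη01.2,
      hn.eventually_ge_atTop 1] with k hk hcardk hnk
    have hN : (0 : ℝ) < n k := by exact_mod_cast hnk
    refine le_trans ?_ hε'ε.le
    rw [← ENNReal.ofReal_coe_nnreal]
    refine ENNReal.ofReal_le_ofReal ?_
    unfold mixingVariance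
    have := hη01.1
    refine inv_card_mul_le (c := c₀ * η) (by positivity) hN hcardk (hk.trans (le_of_eq ?_))
      hε'0.le
    ring
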